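/- Let $n\ge 2$ and let $P\subset\mathbb R^n$ be an $n$-dimensional edge-simple polytope, i.e. an $n$-dimensional convex polytope each of whose edges is contained in exactly $n-1$ facets. Let $\lambda$ be an isotropy function of $P$: a map $\lambda:\mathcal F(P)\to\mathbb Z^{n-1}/\{\pm1\}$ on the set of facets such that, whenever $n-1$ distinct facets $F_{1},\dots,F_{n-1}$ intersect in an edge of $P$, the vectors $\lambda(F_{1}),\dots,\lambda(F_{n-1})$ (well defined up to sign) form a basis of $\mathbb Z^{n-1}$. Write $\mathbb T^{n-1}=(S^1)^{n-1}$. For a face $F$ of $P$ that is not a vertex let $\mathbb T_F\subset\mathbb T^{n-1}=\mathbb R^{n-1}/\mathbb Z^{n-1}$ be the image of the real subspace spanned by the vectors $\lambda(G)$, $G$ a facet containing $F$; for a vertex $v$ put $\mathbb T_v=\mathbb T^{n-1}$. For $S\subseteq P$ let $\sim$ be the relation on $\mathbb T^{n-1}\times S$ with $(t,p)\sim(u,q)$ iff $p=q$ and $tu^{-1}\in\mathbb T_F$, where $F$ is the unique face of $P$ containing $p$ in its relative interior. Let $v_1,\dots,v_k$ be the vertices of $P$, and for each $i$ let $H_i\subset\mathbb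 R^n$ be an affine hyperplane strictly separating $v_i$ from all the other vertices of $P$, such that $H_i\cap H_j\cap P=\emptyset$ for $i\ne j$. Let $Q_P\subset P$ be what remains after cutting off all vertices: the set of points $x\in P$ such that, for every $i$, $x$ lies in the closed half-space bounded by $H_i$ that does not contain $v_i$. Put $P_{H_i}=H_i\cap Q_P$, $$W(Q_P,\lambda)=(\mathbb T^{n-1}\times Q_P)/\!\sim,\qquad W_i=(\mathbb T^{n-1}\times P_{H_i})/\!\sim,$$ with the quotient topologies and the $\mathbb T^{n-1}$-actions induced by multiplication. Theorem. $W(Q_P,\lambda)$ is a topological $(2n-1)$-manifold with boundary (Hausdorff, second countable, locally homeomorphic to a half-space). The natural maps $W_i\to W(Q_P,\lambda)$ are $\mathbb T^{n-1}$-equivariant and together give a closed embedding of the disjoint union $\bigsqcup_{i=1}^k W_i$ into $W(Q_P,\lambda)$ whose image is exactly the boundary; and each $W_i$, with the projection $q_i:W_i\to P_{H_i}$, is a $2(n-1)$-dimensional quasitoric manifold over the $(n-1)$-dimensional simple polytope $P_{H_i}$. Here an $m$-dimensional polytope is simple if each of its vertices lies on exactly $m$ facets. A $2m$-dimensional quasitoric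 manifold over an $m$-dimensional simple polytope $R$ is a manifold $M$ with a continuous $\mathbb T^m$-action and a map $q:M\to R$ such that: the action is locally standard (every point has a $\mathbb T^m$-stable open neighbourhood homeomorphic to a $\mathbb T^m$-stable open subset of $\mathbb C^m$, equivariantly up to an automorphism of $\mathbb T^m$); $q$ is a quotient map whose fibres are exactly the orbits; and the orbit over a point in the relative interior of an $l$-dimensional face of $R$ is $l$-dimensional, i.e. homeomorphic to $\mathbb T^l$. -/

import Mathlib

open Set Topology

/-! ### Convex polytopes, faces, simple and edge-simple polytopes -/

section Polytopes

variable {n : ℕ}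

/-- A (nonempty) convex polytope in `ℝⁿ`: the convex hull of a nonempty finite set of points. -/
def IsPolytope (P : Set (EuclideanSpace ℝ (Fin n))) : Prop :=
  ∃ s : Finset (EuclideanSpace ℝ (Fin n)), s.Nonempty ∧
    P = convexHull ℝ (s : Set (EuclideanSpace ℝ (Fin n)))

/-- The dimension of a convex set: the dimension of its affine span. -/
noncomputable def polyDim (F : Set (EuclideanSpace ℝ (Fin n))) : ℕ :=
  Module.finrank ℝ (vectorSpan ℝ F)

/-- A (nonempty) face of `P`: the set of points of `P` where some linear functional attains its
maximum over `P`. The functional `0` gives `P` itself. -/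
def IsFace (P F : Set (EuclideanSpace ℝ (Fin n))) : Prop :=
  F.Nonempty ∧ IsExposed ℝ P F

/-- A facet: a face of codimension one. -/
def IsFacet (P F : Set (EuclideanSpace ℝ (Fin n))) : Prop :=
  IsFace P F ∧ polyDim F + 1 = polyDim P

/-- An edge: a face of dimension one. -/
def IsEdge (P e : Set (EuclideanSpace ℝ (Fin n))) : Prop :=
  IsFace P e ∧ polyDim e = 1

/-- A vertex: a point which is a (zero-dimensional) face. -/
def IsVertex (P : Set (EuclideanSpace ℝ (Fin n))) (v : EuclideanSpace ℝ (Fin n)) : Prop :=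
  IsFace P {v}

/-- The type of facets of `P`. -/
abbrev Facet (P : Set (EuclideanSpace ℝ (Fin n))) : Type :=
  {F : Set (EuclideanSpace ℝ (Fin n)) // IsFacet P F}

/-- The type of vertices of `P`. -/
abbrev Vertex (P : Set (EuclideanSpace ℝ (Fin n))) : Type :=
  {v : EuclideanSpace ℝ (Fin n) // IsVertex P v}

/-- A `k`-dimensional simple polytope: every vertex lies on exactly `k` facets. -/
structure IsSimplePolytope (k : ℕ) (P : Set (EuclideanSpace ℝ (Fin n))) : Prop where
  isPolytope : IsPolytope P
  dim_eq : polyDim P = k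
  facets_at_vertex : ∀ v, IsVertex P v → {F | IsFacet P F ∧ v ∈ F}.ncard = k

/-- A `k`-dimensional edge-simple polytope: every edge lies on exactly `k - 1` facets. (Every
proper face of a polytope is the intersection of all the facets that contain it.) -/
structure IsEdgeSimplePolytope (k : ℕ) (P : Set (EuclideanSpace ℝ (Fin n))) : Prop where
  isPolytope : IsPolytope P
  dim_eq : polyDim P = k
  facets_at_edge : ∀ e, IsEdge P e → {F | IsFacet P F ∧ e ⊆ F}.ncard + 1 = k

/-- A choice, for every vertex `v` of `P`, of an affine hyperplane
`H v = {x | normal v x = height v}` which strictly separates `v` from all the other vertices of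
`P`, such that no two of the hyperplanes meet inside `P`. -/
structure VertexTruncation (P : Set (EuclideanSpace ℝ (Fin n))) where
  normal : Vertex P → EuclideanSpace ℝ (Fin n) →L[ℝ] ℝ
  height : Vertex P → ℝ
  height_lt : ∀ v : Vertex P, height v < normal v v
  lt_height : ∀ v w : Vertex P, w ≠ v → normal v w < height v
  disjoint : ∀ v w : Vertex P, v ≠ w →
    {x | normal v x = height v} ∩ {x | normal w x = height w} ∩ P = ∅

namespace VertexTruncation

variable {P : Set (EuclideanSpace ℝ (Fin n))}

/-- The hyperplane `H_v`. -/
def hyperplane (H : VertexTruncation P) (v : Vertex P) : Set (EuclideanSpace ℝ (Fin n)) :=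
  {x | H.normal v x = H.height v}

/-- The truncated polytope `Q_P`: what remains of `P` after cutting off all vertices. -/
def truncation (H : VertexTruncation P) : Set (EuclideanSpace ℝ (Fin n)) :=
  {x ∈ P | ∀ v, H.normal v x ≤ H.height v}

/-- The truncation facet `P_{H_v} = H_v ∩ Q_P` corresponding to the vertex `v`. -/
def cutFacet (H : VertexTruncation P) (v : Vertex P) : Set (EuclideanSpace ℝ (Fin n)) :=
  H.hyperplane v ∩ H.truncation

theorem cutFacet_subset (H : VertexTruncation P) (v : Vertex P) :
    H.cutFacet v ⊆ H.truncation :=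
  inter_subset_right

end VertexTruncation

end Polytopes

/-! ### Tori and isotropy functions -/

/-- The compact torus `𝕋ᵈ`. -/
abbrev Torus (d : ℕ) : Type := Fin d → Circle

/-- The set `ℤᵈ / {±1}` of integer vectors up to sign. -/
abbrev SignedVector (d : ℕ) : Type := MulAction.orbitRel.Quotient ℤˣ (Fin d → ℤ)

/-- The class `[v]` of an integer vector up to sign. -/
abbrev SignedVector.mk {d : ℕ} (v : Fin d → ℤ) : SignedVector d :=
  Quotient.mk (MulAction.orbitRel ℤˣ (Fin d → ℤ)) v

/-- The subgroup of `𝕋ᵈ = ℝᵈ/ℤᵈ` corresponding to a submodule `M` of `ℤᵈ`: the image under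
`w ↦ (exp (2πi w₁), …, exp (2πi w_d))` of the real subspace spanned by `M`. -/
noncomputable def subtorus {d : ℕ} (M : Submodule ℤ (Fin d → ℤ)) : Subgroup (Torus d) where
  carrier := {t | ∃ w ∈ Submodule.span ℝ
    ((fun (v : Fin d → ℤ) (i : Fin d) => (v i : ℝ)) '' (M : Set (Fin d → ℤ))),
    t = fun i => Circle.exp (2 * Real.pi * w i)}
  one_mem' := ⟨0, Submodule.zero_mem _, by funext i; simp⟩
  mul_mem' := by
    rintro _ _ ⟨w, hw, rfl⟩ ⟨w', hw', rfl⟩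
    exact ⟨w + w', Submodule.add_mem _ hw hw', by funext i; simp [mul_add]⟩
  inv_mem' := by
    rintro _ ⟨w, hw, rfl⟩
    exact ⟨-w, Submodule.neg_mem _ hw, by funext i; simp⟩

section Isotropy

variable {n : ℕ} {d : ℕ}

/-- `lam` is an isotropy function of the `(d+1)`-dimensional polytope `P`: whenever `d` distinct
facets intersect in an edge, their vectors form a basis of `ℤᵈ`. -/
def IsIsotropyFunction (P : Set (EuclideanSpace ℝ (Fin n)))
    (lam : Facet P → SignedVector d) : Prop :=
  ∀ F : Fin d → Facet P, Function.Injective F → IsEdge P (⋂ i, (F i : Set _)) →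
    ∀ μ : Fin d → (Fin d → ℤ), (∀ i, SignedVector.mk (μ i) = lam (F i)) →
      LinearIndependent ℤ μ ∧ Submodule.span ℤ (Set.range μ) = ⊤

open Classical in
/-- The subgroup `𝕋_F` of `𝕋ᵈ` attached to a face `F` of `P`: the torus corresponding to the
submodule generated by the vectors of the facets containing `F`, respectively the whole of `𝕋ᵈ`
if `F` is a vertex. -/
noncomputable def faceTorus (P : Set (EuclideanSpace ℝ (Fin n))) (lam : Facet P → SignedVector d)
    (F : Set (EuclideanSpace ℝ (Fin n))) : Subgroup (Torus d) :=
  if ∃ v, F = {v} then ⊤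
  else subtorus (Submodule.span ℤ
    {μ | ∃ G : Facet P, F ⊆ (G : Set _) ∧ SignedVector.mk μ = lam G})

/-- The relation `∼` on `𝕋ᵈ × S`, for a subset `S` of the polytope `P`: `(t,p) ∼ (u,q)` iff
`p = q` and `t u⁻¹ ∈ 𝕋_F`, where `F` is the face of `P` with `p` in its relative interior. -/
def torusRel (P : Set (EuclideanSpace ℝ (Fin n))) (lam : Facet P → SignedVector d)
    (S : Set (EuclideanSpace ℝ (Fin n))) (a b : Torus d × S) : Prop :=
  a.2 = b.2 ∧ ∃ F, IsFace P F ∧ (a.2 : EuclideanSpace ℝ (Fin n)) ∈ intrinsicInterior ℝ F ∧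
    a.1 * b.1⁻¹ ∈ faceTorus P lam F

/-- The quotient space `(𝕋ᵈ × S) / ∼`, with the quotient topology. -/
def TorusQuotient (P : Set (EuclideanSpace ℝ (Fin n))) (lam : Facet P → SignedVector d)
    (S : Set (EuclideanSpace ℝ (Fin n))) : Type :=
  Quot (torusRel P lam S)

namespace TorusQuotient

variable {P : Set (EuclideanSpace ℝ (Fin n))} {lam : Facet P → SignedVector d}
  {S S' : Set (EuclideanSpace ℝ (Fin n))}

instance : TopologicalSpace (TorusQuotient P lam S) :=
  inferInstanceAs (TopologicalSpace (Quot (torusRel P lam S)))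

/-- The action of `𝕋ᵈ` on `(𝕋ᵈ × S) / ∼` induced by multiplication: `t • [u, p] = [t u, p]`. -/
noncomputable instance : MulAction (Torus d) (TorusQuotient P lam S) where
  smul t := Quot.map (fun a => (t * a.1, a.2)) (by
    rintro ⟨u, p⟩ ⟨u', p'⟩ ⟨h, F, hF, hp, ht⟩
    refine ⟨h, F, hF, hp, ?_⟩
    have e : t * u * (t * u')⁻¹ = u * u'⁻¹ := by
      rw [mul_inv_rev, mul_comm t u, mul_assoc, mul_comm u'⁻¹, mul_inv_cancel_left]
    simpa only [e] using ht)
  one_smul := by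
    rintro ⟨u, p⟩
    exact congrArg (Quot.mk _) (Prod.ext (one_mul u) rfl)
  mul_smul := by
    rintro s t ⟨u, p⟩
    exact congrArg (Quot.mk _) (Prod.ext (mul_assoc s t u) rfl)

/-- The projection `(𝕋ᵈ × S) / ∼ → S`, `[t, p] ↦ p`. -/
def proj : TorusQuotient P lam S → S :=
  Quot.lift (fun a => a.2) fun _ _ h => h.1

/-- The natural map `(𝕋ᵈ × S) / ∼ → (𝕋ᵈ × S') / ∼` for `S ⊆ S'`, `[t, p] ↦ [t, p]`. -/
def incl (h : S ⊆ S') : TorusQuotient P lam S → TorusQuotient P lam S' :=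
  Quot.map (fun a => (a.1, Set.inclusion h a.2)) (by
    rintro ⟨u, p⟩ ⟨u', p'⟩ ⟨e, F, hF, hp, ht⟩
    exact ⟨congrArg (Set.inclusion h) e, F, hF, hp, ht⟩)

end TorusQuotient

end Isotropy

/-! ### Manifolds with boundary and quasitoric manifolds -/

/-- `M` is a topological `m`-manifold with boundary whose boundary is the set `B`: it is Hausdorff,
second countable, and has an atlas of charts to the half-space `{x ∈ ℝᵐ | 0 ≤ x₀}` each of which
sends exactly the points of `B` in its domain to the bounding hyperplane `x₀ = 0`. -/
structure IsManifoldWithBoundary (m : ℕ) [NeZero m] (M : Type) [TopologicalSpace M]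
    (B : Set M) : Prop where
  t2Space : T2Space M
  secondCountable : SecondCountableTopology M
  exists_atlas : ∃ C : ChartedSpace (EuclideanHalfSpace m) M,
    ∀ e ∈ C.atlas, ∀ x ∈ e.source, x ∈ B ↔ (e x).1 0 = 0

/-- The action of `𝕋ᵈ` on `M` is locally standard: every point has a stable open neighbourhood that
is homeomorphic to a stable open subset of `ℂᵈ` with the coordinatewise action, equivariantly
up to a (continuous) automorphism of `𝕋ᵈ`. -/
def IsLocallyStandard (d : ℕ) (M : Type) [TopologicalSpace M] [MulAction (Torus d) M] : Prop :=
  ∀ y : M, ∃ (ψ : OpenPartialHomeomorph M (Fin d → ℂ)) (δ : Torus d ≃ₜ* Torus d),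
    y ∈ ψ.source ∧
    (∀ t : Torus d, ∀ x ∈ ψ.source, t • x ∈ ψ.source) ∧
    (∀ t : Torus d, ∀ z ∈ ψ.target, (fun i => (t i : ℂ) * z i) ∈ ψ.target) ∧
    ∀ t : Torus d, ∀ x ∈ ψ.source, ψ (t • x) = fun i => (δ t i : ℂ) * ψ x i

/-- `M`, with the given action of `𝕋ᵈ` and the map `q : M → P`, is a `2d`-dimensional quasitoric
manifold over the `d`-dimensional simple polytope `P`: `M` is a (Hausdorff, second countable,
locally Euclidean by local standardness) manifold with a continuous locally standard action, `q` is
the orbit map (it identifies the orbit space of `M` with `P`), and every point whose image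
lies in the relative interior of an `l`-dimensional face has an `l`-dimensional orbit, that is, an
orbit homeomorphic to `𝕋ˡ`. -/
structure IsQuasitoricManifold {n : ℕ} (d : ℕ) (P : Set (EuclideanSpace ℝ (Fin n)))
    (M : Type) [TopologicalSpace M] [MulAction (Torus d) M] (q : M → P) : Prop where
  isSimplePolytope : IsSimplePolytope d P
  t2Space : T2Space M
  secondCountable : SecondCountableTopology M
  continuousSMul : ContinuousSMul (Torus d) M
  locallyStandard : IsLocallyStandard d M
  isQuotientMap : IsQuotientMap q
  fiber_eq_orbit : ∀ x y : M, q x = q y ↔ x ∈ MulAction.orbit (Torus d) y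
  orbit_dim : ∀ x : M, ∃ F, IsFace P F ∧
    (q x : EuclideanSpace ℝ (Fin n)) ∈ intrinsicInterior ℝ F ∧
    Nonempty (MulAction.orbit (Torus d) x ≃ₜ Torus (polyDim F))

/-! Put d = n - 1. Away from the vertices, edge-simplicity makes `P` locally a product of d
half-lines and a line. Let x lie in `P` and let m be a linear functional whose value at x is taken
at no vertex. Slice the face of x by the level set of m through x and take an extreme point z of the
slice. The face of z is then an edge along which m is not constant. Exactly d facets contain this
edge, among them all the facets through x. Together with m they form linear coordinates, and their
vectors form a basis of the lattice. This is an `EdgeFrame`, produced by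
`FacetInequalities.exists_edgeFrame`. Any point that is not a vertex can be moved slightly inside
its face so that a suitable m exists.

In the coordinates of a frame, `P` is locally given by d sign conditions. After the automorphism of
the torus defined by the lattice basis, the group of a nearby point consists of the t with trivial
i-th coordinate for every frame facet i missing the point (`EdgeFrame.exists_automorphism`). Polar
coordinates identify the quotient of the torus times d half-lines by these groups with ℂᵈ
(`TorusQuotient.exists_polarChart`). Hence the quotient has charts in ℂᵈ times an interval.

No vertex lies on a cutting hyperplane, so at its points m may be the normal of the hyperplane. The
last coordinate then runs through a half-line and vanishes exactly over the cut facet, which gives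
the boundary charts. Fixing it to be zero gives the locally standard charts of the quotient over the
cut facet. The same frames describe the faces of the cut facet, whence its simplicity and the orbit
dimensions. Caps at different vertices do not meet (`VertexTruncation.normal_lt_of_le`), so only one
cut matters near a given point.

The global claims are soft: each fibre of the projection lies in one chart, so the quotient is
Hausdorff, and everything is compact. The facet inequalities used throughout come from the polar
dual and an irredundant choice of inequalities. -/

/-! ### Polyhedra given by finitely many inequalities -/

section Polyhedra

variable {V ι : Type*} [NormedAddCommGroup V] [NormedSpace ℝ V]

/-- The polyhedron defined by the inequalities `a i x ≤ b i`. -/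
def polyhedron (a : ι → V →L[ℝ] ℝ) (b : ι → ℝ) : Set V := {x | ∀ i, a i x ≤ b i}

/-- The subset of the polyhedron where all the inequalities that are sharp at `x` are sharp. -/
def activeFace (a : ι → V →L[ℝ] ℝ) (b : ι → ℝ) (x : V) : Set V :=
  {y ∈ polyhedron a b | ∀ i, a i x = b i → a i y = b i}

variable {a : ι → V →L[ℝ] ℝ} {b : ι → ℝ} {x : V}

theorem self_mem_activeFace (hx : x ∈ polyhedron a b) : x ∈ activeFace a b x :=
  ⟨hx, fun _ h => h⟩

theorem isClosed_polyhedron : IsClosed (polyhedron a b) := by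
  have : polyhedron a b = ⋂ i, {x | a i x ≤ b i} := by ext; simp [polyhedron]
  rw [this]
  exact isClosed_iInter fun i => isClosed_le (a i).continuous continuous_const

theorem convex_polyhedron : Convex ℝ (polyhedron a b) := by
  intro x hx y hy s t hs ht hst i
  simp only [map_add, map_smul, smul_eq_mul]
  calc s * a i x + t * a i y ≤ s * b i + t * b i :=
        add_le_add (mul_le_mul_of_nonneg_left (hx i) hs) (mul_le_mul_of_nonneg_left (hy i) ht)
    _ = b i := by rw [← add_mul, hst, one_mul]

theorem isClosed_activeFace : IsClosed (activeFace a b x) := by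
  have : activeFace a b x = polyhedron a b ∩ ⋂ i, ⋂ _ : a i x = b i, {y | a i y = b i} := by
    ext; simp [activeFace]
  rw [this]
  exact isClosed_polyhedron.inter <| isClosed_iInter fun i => isClosed_iInter fun _ =>
    isClosed_eq (a i).continuous continuous_const

/-- A segment ending at a point of the relative interior can be prolonged. -/
theorem exists_extend_of_mem_intrinsicInterior {F : Set V} {y : V}
    (hx : x ∈ intrinsicInterior ℝ F) (hy : y ∈ F) :
    ∃ ε : ℝ, 0 < ε ∧ x + ε • (x - y) ∈ F := by
  obtain ⟨⟨x', hx'⟩, hint, rfl⟩ := hx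
  have hy' := subset_affineSpan ℝ F hy
  let f : ℝ → affineSpan ℝ F := fun ε => ⟨x' + ε • (x' - y), by
    have := AffineMap.lineMap_mem (-ε) hx' hy'
    rw [AffineMap.lineMap_apply] at this
    convert this using 1
    simp only [vsub_eq_sub, vadd_eq_add, neg_smul, smul_sub]
    abel⟩
  have hf : Continuous f := by
    refine Continuous.subtype_mk ?_ _
    fun_prop
  have h0 : f 0 = ⟨x', hx'⟩ := by simp [f]
  have := (hf.tendsto 0).eventually (h0 ▸ mem_interior_iff_mem_nhds.1 hint)
  obtain ⟨ε, h, hε⟩ := ((this.filter_mono nhdsWithin_le_nhds).and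
    (self_mem_nhdsWithin : Ioi (0 : ℝ) ∈ 𝓝[>] 0)).exists
  exact ⟨ε, hε, h⟩

/-- A linear functional which attains its maximum over `F` at a point of the relative interior is
constant on `F`. -/
theorem eq_of_mem_intrinsicInterior {F : Set V} {y : V} {l : V →L[ℝ] ℝ}
    (hx : x ∈ intrinsicInterior ℝ F) (hl : ∀ z ∈ F, l z ≤ l x) (hy : y ∈ F) : l y = l x := by
  obtain ⟨ε, hε, h⟩ := exists_extend_of_mem_intrinsicInterior hx hy
  have h1 := hl _ h
  simp only [map_add, map_smul, map_sub, smul_eq_mul] at h1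
  have h2 := hl _ hy
  nlinarith

/-- A point which is determined by its sharp inequalities is a face. -/
theorem activeFace_eq_singleton (hx : x ∈ polyhedron a b)
    (h : ∀ u, (∀ i, a i x = b i → a i u = 0) → u = 0) : activeFace a b x = {x} := by
  refine Subset.antisymm (fun y hy => ?_) (by simpa using self_mem_activeFace hx)
  rw [mem_singleton_iff, ← sub_eq_zero]
  exact h _ fun i hi => by rw [map_sub, hi, hy.2 i hi, sub_self]

variable [Finite ι]

/-- Moving a little from `x` in an inward direction `u`: the sharp inequalities are those sharp at
`x` whose functional vanishes on `u`. -/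
theorem eventually_active (hx : x ∈ polyhedron a b) {u : V}
    (hu : ∀ i, a i x = b i → a i u ≤ 0) :
    ∀ᶠ ε : ℝ in 𝓝[>] 0, ∀ i, a i (x + ε • u) ≤ b i ∧
      (a i (x + ε • u) = b i ↔ a i x = b i ∧ a i u = 0) := by
  refine Filter.eventually_all.2 fun i => ?_
  by_cases h : a i x = b i
  · filter_upwards [self_mem_nhdsWithin] with ε hε
    have hε : (0 : ℝ) < ε := hε
    have := hu i h
    simp only [map_add, map_smul, smul_eq_mul, h, true_and]
    refine ⟨by nlinarith, ?_⟩
    constructor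
    · intro h'
      have : ε * a i u = 0 := by linarith
      exact (mul_eq_zero.1 this).resolve_left hε.ne'
    · intro h'; simp [h']
  · have hlt : a i x < b i := lt_of_le_of_ne (hx i) h
    have hc : Filter.Tendsto (fun ε : ℝ => a i (x + ε • u)) (𝓝[>] 0) (𝓝 (a i x)) := by
      have : Continuous fun ε : ℝ => a i (x + ε • u) := by fun_prop
      have := this.tendsto 0
      simp only [zero_smul, add_zero] at this
      exact this.mono_left nhdsWithin_le_nhds
    filter_upwards [hc.eventually (gt_mem_nhds hlt)] with ε hε
    exact ⟨hε.le, fun h' => absurd h' hε.ne, fun h' => absurd h'.1 h⟩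

theorem exists_active (hx : x ∈ polyhedron a b) {u : V}
    (hu : ∀ i, a i x = b i → a i u ≤ 0) :
    ∃ ε : ℝ, 0 < ε ∧ x + ε • u ∈ polyhedron a b ∧
      ∀ i, a i (x + ε • u) = b i ↔ a i x = b i ∧ a i u = 0 := by
  obtain ⟨ε, h, hε⟩ := ((eventually_active hx hu).and self_mem_nhdsWithin).exists
  exact ⟨ε, hε, fun i => (h i).1, fun i => (h i).2⟩

/-- A direction killed by the sharp functionals can be followed a little way inside the polyhedron
without leaving the face. This reduces dimensions of faces to linear algebra. -/
theorem mem_vectorSpan_activeFace (hx : x ∈ polyhedron a b) {u : V} :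
    u ∈ vectorSpan ℝ (activeFace a b x) ↔ ∀ i, a i x = b i → a i u = 0 := by
  constructor
  · intro hu i hi
    have : vectorSpan ℝ (activeFace a b x) ≤ LinearMap.ker (a i).toLinearMap := by
      rw [vectorSpan_def, Submodule.span_le]
      rintro _ ⟨y, hy, z, hz, rfl⟩
      simp [hy.2 i hi, hz.2 i hi]
    exact this hu
  · intro hu
    obtain ⟨ε, hε, hm, hact⟩ := exists_active hx (fun i hi => (hu i hi).le)
    have h1 : x + ε • u ∈ activeFace a b x := ⟨hm, fun i hi => (hact i).2 ⟨hi, hu i hi⟩⟩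
    have h2 := vsub_mem_vectorSpan ℝ h1 (self_mem_activeFace hx)
    simp only [vsub_eq_sub, add_sub_cancel_left] at h2
    have := Submodule.smul_mem _ ε⁻¹ h2
    rwa [smul_smul, inv_mul_cancel₀ hε.ne', one_smul] at this

theorem mem_intrinsicInterior_activeFace (hx : x ∈ polyhedron a b) :
    x ∈ intrinsicInterior ℝ (activeFace a b x) := by
  have hxs : x ∈ affineSpan ℝ (activeFace a b x) :=
    subset_affineSpan ℝ _ (self_mem_activeFace hx)
  refine ⟨⟨x, hxs⟩, ?_, rfl⟩
  rw [mem_interior]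
  -- On the affine span of the face the inequalities sharp at `x` are automatically equalities, so
  -- the remaining strict ones define a neighbourhood.
  refine ⟨⋂ i : {i // a i x ≠ b i}, {y | a i y < b i}, ?_,
    isOpen_iInter_of_finite fun i => isOpen_lt (by fun_prop) continuous_const, ?_⟩
  · rintro ⟨y, hy⟩ hy'
    simp only [mem_iInter, mem_ofPred_eq, Subtype.forall] at hy'
    have hact : ∀ i, a i x = b i → a i y = b i := by
      intro i hi
      have h1 := vsub_mem_vectorSpan_of_mem_affineSpan_of_mem_affineSpan hy hxs
      have h2 := (mem_vectorSpan_activeFace hx).1 h1 i hi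
      rw [vsub_eq_sub, map_sub, sub_eq_zero] at h2
      rw [h2, hi]
    refine ⟨fun i => ?_, hact⟩
    by_cases hi : a i x = b i
    · exact (hact i hi).le
    · exact (hy' i hi).le
  · simp only [mem_iInter, mem_ofPred_eq, Subtype.forall]
    exact fun i hi => lt_of_le_of_ne (hx i) hi

theorem isExposed_activeFace (hx : x ∈ polyhedron a b) :
    IsExposed ℝ (polyhedron a b) (activeFace a b x) := by
  classical
  intro _
  have := Fintype.ofFinite ι
  -- The sum of the sharp functionals is maximal exactly where every summand is.
  refine ⟨∑ i with a i x = b i, a i, ?_⟩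
  ext y
  simp only [mem_ofPred_eq, sum_apply]
  constructor
  · intro hy
    refine ⟨hy.1, fun z hz => Finset.sum_le_sum fun i hi => ?_⟩
    rw [hy.2 i (Finset.mem_filter.1 hi).2]
    exact hz i
  · rintro ⟨hy, h⟩
    refine ⟨hy, fun i hi => ?_⟩
    have h1 : ∑ i with a i x = b i, a i y = ∑ i with a i x = b i, b i := by
      refine le_antisymm (Finset.sum_le_sum fun i _ => hy i) ((h x hx).trans' (le_of_eq ?_))
      exact Finset.sum_congr rfl fun i hi => (Finset.mem_filter.1 hi).2.symm
    exact (Finset.sum_eq_sum_iff_of_le fun i _ => hy i).1 h1 i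
      (Finset.mem_filter.2 ⟨Finset.mem_univ _, hi⟩)

/-- The face of a polyhedron with a given point in its relative interior. -/
theorem eq_activeFace_of_mem_intrinsicInterior {F : Set V}
    (hF : IsExposed ℝ (polyhedron a b) F) (hx : x ∈ intrinsicInterior ℝ F) :
    F = activeFace a b x := by
  have hxF : x ∈ F := intrinsicInterior_subset hx
  obtain ⟨l, hl⟩ := hF ⟨x, hxF⟩
  have hsub : F ⊆ polyhedron a b := by rw [hl]; exact sep_subset _ _
  have hxP := hsub hxF
  refine Subset.antisymm (fun y hy => ⟨hsub hy, fun i hi => ?_⟩) fun y hy => ?_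
  · rw [← hi]
    exact eq_of_mem_intrinsicInterior hx (fun z hz => (hsub hz i).trans hi.ge) hy
  · have hmax : ∀ z ∈ polyhedron a b, l z ≤ l x := by
      rw [hl] at hxF; exact hxF.2
    have := eq_of_mem_intrinsicInterior (mem_intrinsicInterior_activeFace hxP)
      (l := l) (fun z hz => hmax z hz.1) hy
    rw [hl]
    exact ⟨hy.1, fun z hz => this ▸ hmax z hz⟩

/-- Otherwise the point would be the midpoint of a segment in the polyhedron in the directions `u`
and `-u`. -/
theorem eq_zero_of_mem_extremePoints {u : V} (hx : x ∈ (polyhedron a b).extremePoints ℝ)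
    (hu : ∀ i, a i x = b i → a i u = 0) : u = 0 := by
  have hxP := hx.1
  have h1 := eventually_active hxP (fun i hi => (hu i hi).le)
  have h2 := eventually_active hxP (u := -u) (fun i hi => by simp [hu i hi])
  obtain ⟨ε, ⟨h1, h2⟩, hε⟩ := ((h1.and h2).and self_mem_nhdsWithin).exists
  have hε : (0 : ℝ) < ε := hε
  have := hx.2 (x₁ := x + ε • u) (x₂ := x + ε • -u) (fun i => (h1 i).1) (fun i => (h2 i).1)
    ⟨1 / 2, 1 / 2, by norm_num, by norm_num, by norm_num, by
      simp only [smul_add, smul_neg]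
      rw [add_add_add_comm, add_neg_cancel, add_zero, ← add_smul]; norm_num⟩
  have h3 : ε • u = 0 := by simpa using this
  exact (smul_eq_zero.1 h3).resolve_left hε.ne'

/-- An extreme point is determined by its set of sharp inequalities, and there are finitely many
such sets. -/
theorem finite_extremePoints_polyhedron : ((polyhedron a b).extremePoints ℝ).Finite := by
  refine Set.Finite.of_finite_image (f := fun x => {i | a i x = b i}) (Set.toFinite _) ?_
  intro x hx y hy hxy
  have : y - x = 0 := eq_zero_of_mem_extremePoints hx fun i hi => by
    have : a i y = b i := (Set.ext_iff.1 hxy i).1 hi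
    rw [map_sub, hi, this, sub_self]
  exact (sub_eq_zero.1 this).symm

/-- Krein–Milman; the closure is superfluous because the extreme points are finite in number. -/
theorem convexHull_extremePoints_polyhedron (hc : IsCompact (polyhedron a b)) :
    convexHull ℝ ((polyhedron a b).extremePoints ℝ) = polyhedron a b := by
  have := closure_convexHull_extremePoints hc convex_polyhedron
  rwa [(finite_extremePoints_polyhedron.isCompact_convexHull ℝ).isClosed.closure_eq] at this

/-- A convex hull of finitely many points with nonempty interior is a polyhedron. -/
theorem exists_eq_polyhedron [FiniteDimensional ℝ V] (s : Finset V)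
    (hs : (interior (convexHull ℝ (s : Set V))).Nonempty) :
    ∃ (T : Finset (V →L[ℝ] ℝ)) (x₀ : V),
      convexHull ℝ (s : Set V) = polyhedron (fun f : T => f.1) fun f => 1 + f.1 x₀ := by
  obtain ⟨x₀, hx₀⟩ := hs
  have hx₀s := interior_subset hx₀
  -- `D` is the polar dual of the hull about the interior point `x₀`. It is itself a polyhedron,
  -- bounded because `x₀` is interior, so its finitely many extreme points can serve as the required
  -- inequalities.
  let A : s → (V →L[ℝ] ℝ) →L[ℝ] ℝ := fun y => ContinuousLinearMap.apply ℝ ℝ (y.1 - x₀)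
  let D := polyhedron A fun _ => 1
  have hD : ∀ f ∈ D, ∀ y ∈ convexHull ℝ (s : Set V), f (y - x₀) ≤ 1 := by
    intro f hf y hy
    have hc : Convex ℝ {y | f (y - x₀) ≤ 1} := by
      have : {y | f (y - x₀) ≤ 1} = {y | f y ≤ 1 + f x₀} := by
        ext; simp
      rw [this]
      exact convex_halfSpace_le f.isLinear _
    exact convexHull_min (fun y hy => hf ⟨y, hy⟩) hc hy
  have hcomp : IsCompact D := by
    obtain ⟨r, hr, hball⟩ := Metric.mem_nhds_iff.1 (mem_interior_iff_mem_nhds.1 hx₀)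
    refine Metric.isCompact_of_isClosed_isBounded isClosed_polyhedron ?_
    refine (Metric.isBounded_closedBall (x := (0 : V →L[ℝ] ℝ)) (r := (r / 2)⁻¹)).subset ?_
    intro f hf
    rw [mem_closedBall_zero_iff]
    refine ContinuousLinearMap.opNorm_le_of_unit_norm (by positivity) fun u hu => ?_
    have key : ∀ u : V, ‖u‖ = 1 → f u ≤ (r / 2)⁻¹ := by
      intro u hu
      have h1 := hD f hf (x₀ + (r / 2) • u) (hball (by
        rw [Metric.mem_ball, dist_eq_norm, add_sub_cancel_left, norm_smul, hu, mul_one,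
          Real.norm_of_nonneg (by positivity)]
        linarith))
      rw [add_sub_cancel_left, map_smul, smul_eq_mul] at h1
      rw [inv_eq_one_div, le_div_iff₀ (by positivity)]
      linarith
    rw [Real.norm_eq_abs, abs_le]
    have h2 := key (-u) (by rwa [norm_neg])
    rw [map_neg] at h2
    exact ⟨by linarith, key u hu⟩
  have hfin := finite_extremePoints_polyhedron (a := A) (b := fun _ => 1)
  refine ⟨hfin.toFinset, x₀, Subset.antisymm ?_ ?_⟩
  · rintro y hy ⟨f, hf⟩
    have h1 := hD f (hfin.mem_toFinset.1 hf).1 y hy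
    rw [map_sub] at h1
    simp only
    linarith
  · intro y hy
    by_contra hyP
    obtain ⟨f, c, hf, hfy⟩ := geometric_hahn_banach_closed_point (convex_convexHull ℝ (s : Set V))
      (s.finite_toSet.isCompact_convexHull ℝ).isClosed hyP
    -- A separating functional, rescaled to lie in the polar, is a convex combination of extreme
    -- points of the polar, so one of those must already be violated at `y`.
    have hc : 0 < c - f x₀ := sub_pos.2 (hf _ hx₀s)
    have hgD : (c - f x₀)⁻¹ • f ∈ D := by
      intro z
      have := hf z.1 (subset_convexHull ℝ _ z.2)
      change (c - f x₀)⁻¹ * f (z.1 - x₀) ≤ 1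
      rw [map_sub]
      rw [inv_mul_le_iff₀ hc]
      linarith
    have hgD := (convexHull_extremePoints_polyhedron hcomp).ge hgD
    have hc' : Convex ℝ {g : V →L[ℝ] ℝ | g (y - x₀) ≤ 1} :=
      convex_halfSpace_le (ContinuousLinearMap.apply ℝ ℝ (y - x₀)).isLinear _
    have h1 := convexHull_min (t := {g : V →L[ℝ] ℝ | g (y - x₀) ≤ 1}) (fun g hg => by
      have := hy ⟨g, hfin.mem_toFinset.2 hg⟩
      simp only at this
      rw [mem_ofPred_eq, map_sub]
      linarith) hc' hgD
    simp only [mem_ofPred_eq, smul_apply, smul_eq_mul, map_sub] at h1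
    rw [← mul_sub, inv_mul_le_iff₀ hc] at h1
    linarith

end Polyhedra

/-! ### Facets of a full-dimensional polytope -/

section Crossing

variable {V : Type*} [AddCommGroup V] [Module ℝ V] [TopologicalSpace V]

/-- A segment whose end points lie on different sides of a hyperplane meets the hyperplane. -/
theorem exists_mem_segment_eq {l : V →L[ℝ] ℝ} {p q : V} {c : ℝ} (hp : l p < c) (hq : c < l q) :
    ∃ t : ℝ, 0 < t ∧ t < 1 ∧ l (p + t • (q - p)) = c := by
  have h : 0 < l q - l p := by linarith
  refine ⟨(c - l p) / (l q - l p), div_pos (by linarith) h, (div_lt_one h).2 (by linarith), ?_⟩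
  simp only [map_add, map_smul, map_sub, smul_eq_mul]
  field_simp
  ring

end Crossing

section Facets

variable {n : ℕ} {P : Set (EuclideanSpace ℝ (Fin n))}

theorem IsPolytope.isCompact (hP : IsPolytope P) : IsCompact P := by
  obtain ⟨s, -, rfl⟩ := hP
  exact s.finite_toSet.isCompact_convexHull ℝ

theorem IsPolytope.convex (hP : IsPolytope P) : Convex ℝ P := by
  obtain ⟨s, -, rfl⟩ := hP
  exact convex_convexHull ℝ _

theorem IsPolytope.nonempty (hP : IsPolytope P) : P.Nonempty := by
  obtain ⟨s, hs, rfl⟩ := hP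
  simpa using hs

theorem isFace_activeFace {ι : Type*} [Finite ι] {a : ι → EuclideanSpace ℝ (Fin n) →L[ℝ] ℝ}
    {b : ι → ℝ} {x : EuclideanSpace ℝ (Fin n)} (hx : x ∈ polyhedron a b) :
    IsFace (polyhedron a b) (activeFace a b x) :=
  ⟨⟨x, self_mem_activeFace hx⟩, isExposed_activeFace hx⟩

theorem IsFace.subset {F : Set (EuclideanSpace ℝ (Fin n))} (hF : IsFace P F) : F ⊆ P := by
  obtain ⟨l, hl⟩ := hF.2 hF.1
  rw [hl]
  exact sep_subset _ _

theorem IsFace.convex {F : Set (EuclideanSpace ℝ (Fin n))} (hF : IsFace P F) (hP : Convex ℝ P) :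
    Convex ℝ F :=
  hF.2.convex hP

theorem IsPolytope.interior_nonempty (hP : IsPolytope P) (hdim : polyDim P = n) :
    (interior P).Nonempty := by
  rw [hP.convex.interior_nonempty_iff_affineSpan_eq_top,
    AffineSubspace.affineSpan_eq_top_iff_vectorSpan_eq_top_of_nonempty _ _ _ hP.nonempty]
  exact Submodule.eq_top_of_finrank_eq (by simpa [polyDim] using hdim)

theorem lt_of_mem_interior {l : EuclideanSpace ℝ (Fin n) →L[ℝ] ℝ} (hl : l ≠ 0) {c : ℝ}
    (hc : ∀ x ∈ P, l x ≤ c) {y : EuclideanSpace ℝ (Fin n)} (hy : y ∈ interior P) : l y < c := by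
  have hu : ∃ u, 0 < l u := by
    by_contra! h
    refine hl (ContinuousLinearMap.ext fun u => le_antisymm (h u) ?_)
    have := h (-u)
    rw [map_neg] at this
    simpa using this
  obtain ⟨u, hu⟩ := hu
  have hc' : Continuous fun ε : ℝ => y + ε • u := by fun_prop
  have hP : ∀ᶠ z in 𝓝 (y + (0 : ℝ) • u), z ∈ P := by
    rw [zero_smul, add_zero]
    exact mem_interior_iff_mem_nhds.1 hy
  have := (hc'.tendsto 0).eventually hP
  obtain ⟨ε, h, hε⟩ := ((this.filter_mono nhdsWithin_le_nhds).and
    (self_mem_nhdsWithin : Ioi (0 : ℝ) ∈ 𝓝[>] 0)).exists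
  have h1 := hc _ h
  have hε : 0 < ε := hε
  simp only [map_add, map_smul, smul_eq_mul] at h1
  nlinarith [mul_pos hε hu]

/-- An irredundant description of a full-dimensional polytope by inequalities: each inequality is
the only sharp one at some point. -/
theorem IsPolytope.exists_irredundant (hP : IsPolytope P) (hdim : polyDim P = n) :
    ∃ (T : Finset (EuclideanSpace ℝ (Fin n) →L[ℝ] ℝ)) (β : T → ℝ),
      P = polyhedron (fun f : T => f.1) β ∧ ∀ f : T, f.1 ≠ 0 ∧
        ∃ p ∈ P, ∀ g : T, g.1 p = β g ↔ g = f := by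
  classical
  obtain ⟨y, hy⟩ := hP.interior_nonempty hdim
  have hyP := interior_subset hy
  obtain ⟨s, -, hs⟩ := id hP
  obtain ⟨T₀, x₀, hT₀⟩ := exists_eq_polyhedron s (by rw [← hs]; exact ⟨y, hy⟩)
  let β : (EuclideanSpace ℝ (Fin n) →L[ℝ] ℝ) → ℝ := fun f => 1 + f x₀
  -- Take a set of inequalities that is minimal for inclusion; dropping any `f` then admits a point
  -- `z` violating only `f`.
  obtain ⟨T, hT, hmin⟩ := (wellFounded_lt (α := Finset (EuclideanSpace ℝ (Fin n) →L[ℝ] ℝ))).has_min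
    {T | ∀ x, x ∈ P ↔ ∀ f ∈ T, f x ≤ β f} ⟨T₀, fun x => by
      rw [hs, hT₀]
      exact ⟨fun h f hf => h ⟨f, hf⟩, fun h f => h f.1 f.2⟩⟩
  have hTP : ∀ x, x ∈ P ↔ ∀ f ∈ T, f x ≤ β f := hT
  have hz : ∀ f ∈ T, ∃ z, (∀ g ∈ T, g ≠ f → g z ≤ β g) ∧ β f < f z := by
    intro f hf
    by_contra! h
    refine hmin (T.erase f) (fun x => ?_) (Finset.erase_ssubset hf)
    rw [hTP]
    constructor
    · exact fun hx g hg => hx g (Finset.mem_of_mem_erase hg)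
    · intro hx g hg
      by_cases hgf : g = f
      · rw [hgf]
        exact h x fun g hg hgf => hx g (Finset.mem_erase.2 ⟨hgf, hg⟩)
      · exact hx g (Finset.mem_erase.2 ⟨hgf, hg⟩)
  have hne : ∀ f ∈ T, f ≠ 0 := by
    rintro f hf rfl
    obtain ⟨z, -, hz⟩ := hz 0 hf
    have := (hTP y).1 hyP 0 hf
    simp only [zero_apply] at this hz
    exact absurd hz this.not_gt
  have hlt : ∀ f ∈ T, f y < β f := fun f hf =>
    lt_of_mem_interior (hne f hf) (fun x hx => (hTP x).1 hx f hf) hy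
  refine ⟨T, fun f => β f.1, ?_, fun f => ⟨hne f.1 f.2, ?_⟩⟩
  · ext x
    rw [hTP]
    exact ⟨fun h f => h f.1 f.2, fun h f hf => h ⟨f, hf⟩⟩
  · obtain ⟨z, hz, hfz⟩ := hz f.1 f.2
    -- On the segment from the interior point to `z`, only `f` becomes sharp at the crossing, since
    -- the others are strict at the start and hold at the end.
    obtain ⟨t, ht0, ht1, ht⟩ := exists_mem_segment_eq (hlt f.1 f.2) hfz
    have hother : ∀ g ∈ T, g ≠ f.1 → g (y + t • (z - y)) < β g := by
      intro g hg hgf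
      have h1 := hlt g hg
      have h2 := hz g hg hgf
      simp only [map_add, map_smul, map_sub, smul_eq_mul]
      nlinarith
    refine ⟨y + t • (z - y), (hTP _).2 fun g hg => ?_, fun g => ⟨fun h => ?_, ?_⟩⟩
    · by_cases hgf : g = f.1
      · rw [hgf, ht]
      · exact (hother g hg hgf).le
    · by_contra hgf
      exact (hother g.1 g.2 fun h => hgf (Subtype.ext h)).ne h
    · rintro rfl
      exact ht

/-- A full-dimensional polytope has finitely many facets and is described by one inequality for
each facet, the facet being the set where the inequality is sharp. -/
theorem IsPolytope.exists_facet_inequalities (hP : IsPolytope P) (hdim : polyDim P = n) :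
    Finite (Facet P) ∧ ∃ (a : Facet P → EuclideanSpace ℝ (Fin n) →L[ℝ] ℝ) (b : Facet P → ℝ),
      P = polyhedron a b ∧ ∀ F : Facet P, ∀ x ∈ P, x ∈ (F : Set _) ↔ a F x = b F := by
  obtain ⟨T, β, hPT, hT⟩ := hP.exists_irredundant hdim
  have hker : ∀ f : T, Module.finrank ℝ (LinearMap.ker f.1.toLinearMap) + 1 = n := fun f => by
    have := Module.Dual.finrank_ker_add_one_of_ne_zero (K := ℝ) (V₁ := EuclideanSpace ℝ (Fin n))
      (f := f.1.toLinearMap) (fun h => (hT f).1 (by ext1 x; exact DFunLike.congr_fun h x))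
    simpa using this
  have hex : ∀ f : T, IsFacet P {x ∈ P | f.1 x = β f} := by
    intro f
    obtain ⟨-, p, hp, hpf⟩ := hT f
    have hpT : p ∈ polyhedron (fun f : T => f.1) β := hPT ▸ hp
    have heq : {x ∈ P | f.1 x = β f} = activeFace (fun f : T => f.1) β p := by
      ext x
      rw [hPT]
      constructor
      · rintro ⟨hx, hfx⟩
        exact ⟨hx, fun g hg => by rw [(hpf g).1 hg, hfx]⟩
      · rintro ⟨hx, h⟩
        exact ⟨hx, h f ((hpf f).2 rfl)⟩
    rw [heq]
    refine ⟨by rw [hPT]; exact isFace_activeFace hpT, ?_⟩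
    have : vectorSpan ℝ (activeFace (fun f : T => f.1) β p) = LinearMap.ker f.1.toLinearMap := by
      ext u
      rw [mem_vectorSpan_activeFace hpT]
      simp only [hpf, forall_eq]
      rfl
    rw [hdim, polyDim, this, hker]
  have hall : ∀ F : Facet P, ∃ f : T, ∀ x ∈ P, x ∈ (F : Set _) ↔ f.1 x = β f := by
    rintro ⟨F, hF, hFdim⟩
    obtain ⟨p, hp⟩ := hF.1.intrinsicInterior (hF.convex hP.convex)
    have hpF := intrinsicInterior_subset hp
    have hpT : p ∈ polyhedron (fun f : T => f.1) β := hPT ▸ hF.subset hpF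
    have hFT : IsExposed ℝ (polyhedron (fun f : T => f.1) β) F := hPT ▸ hF.2
    have hFact := eq_activeFace_of_mem_intrinsicInterior hFT hp
    obtain ⟨f, hf⟩ : ∃ f : T, f.1 p = β f := by
      by_contra! h
      have : F = P := by
        rw [hFact, hPT]
        exact Subset.antisymm (sep_subset _ _) fun x hx => ⟨hx, fun i hi => absurd hi (h i)⟩
      rw [this] at hFdim
      omega
    -- By dimension the facet spans the whole kernel of one sharp functional, so sharpness of that
    -- functional forces all the inequalities sharp at `p`.
    have hspan : vectorSpan ℝ F = LinearMap.ker f.1.toLinearMap := by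
      refine Submodule.eq_of_le_of_finrank_eq (fun u hu => ?_) ?_
      · rw [hFact, mem_vectorSpan_activeFace hpT] at hu
        exact hu f hf
      · have := hker f
        rw [polyDim, hdim] at hFdim
        omega
    refine ⟨f, fun x hx => ⟨fun hxF => ?_, fun hfx => ?_⟩⟩
    · exact (hFact.le hxF).2 f hf
    · refine hFact.ge ⟨hPT ▸ hx, ?_⟩
      have hu : x - p ∈ vectorSpan ℝ F := by
        rw [hspan]
        simp [hfx, hf]
      rw [hFact, mem_vectorSpan_activeFace hpT] at hu
      intro g hg
      have := hu g hg
      rw [map_sub, hg, sub_eq_zero] at this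
      exact this
  choose φ hφ using hall
  have hinj : Function.Injective φ := by
    intro F G h
    refine Subtype.ext (Set.ext fun x => ?_)
    by_cases hx : x ∈ P
    · rw [hφ F x hx, hφ G x hx, h]
    · exact ⟨fun h => absurd (F.2.1.subset h) hx, fun h => absurd (G.2.1.subset h) hx⟩
  refine ⟨Finite.of_injective φ hinj, fun F => (φ F).1, fun F => β (φ F), ?_, hφ⟩
  refine Subset.antisymm (fun x hx F => ?_) fun x hx => ?_
  · rw [hPT] at hx
    exact hx (φ F)
  · rw [hPT]
    intro f
    -- No inequality is lost: the facet cut out by `f` is assigned `f` itself, the only one sharp at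
    -- `p`.
    obtain ⟨-, p, hp, hpf⟩ := hT f
    have h1 := (hφ ⟨_, hex f⟩ p hp).1 ⟨hp, (hpf f).2 rfl⟩
    have h2 := (hpf _).1 h1
    have := hx ⟨_, hex f⟩
    simp only at this
    rwa [h2] at this

/-- Vertices are extreme points. -/
theorem IsVertex.mem_extremePoints {v : EuclideanSpace ℝ (Fin n)} (hv : IsVertex P v) :
    v ∈ P.extremePoints ℝ :=
  isExtreme_singleton.1 hv.2.isExtreme

theorem IsVertex.mem {v : EuclideanSpace ℝ (Fin n)} (hv : IsVertex P v) : v ∈ P :=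
  hv.mem_extremePoints.1

theorem isVertex_iff_mem_extremePoints {ι : Type*} [Finite ι]
    {a : ι → EuclideanSpace ℝ (Fin n) →L[ℝ] ℝ} {b : ι → ℝ} {v : EuclideanSpace ℝ (Fin n)} :
    IsVertex (polyhedron a b) v ↔ v ∈ (polyhedron a b).extremePoints ℝ := by
  refine ⟨IsVertex.mem_extremePoints, fun hv => ?_⟩
  have := isFace_activeFace hv.1
  rwa [activeFace_eq_singleton hv.1 fun u hu => eq_zero_of_mem_extremePoints hv hu] at this

theorem isPolytope_polyhedron {ι : Type*} [Finite ι]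
    {a : ι → EuclideanSpace ℝ (Fin n) →L[ℝ] ℝ} {b : ι → ℝ} (hc : IsCompact (polyhedron a b))
    (hne : (polyhedron a b).Nonempty) : IsPolytope (polyhedron a b) := by
  have hfin := finite_extremePoints_polyhedron (a := a) (b := b)
  have := convexHull_extremePoints_polyhedron hc
  refine ⟨hfin.toFinset, ?_, by rw [hfin.coe_toFinset, this]⟩
  rw [hfin.toFinset_nonempty, ← convexHull_nonempty_iff (𝕜 := ℝ), this]
  exact hne

end Facets

/-! ### Hyperplane sections -/

section HyperplaneSection

variable {V ι : Type*} [NormedAddCommGroup V] [NormedSpace ℝ V]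

/-- The functionals describing the section of a polyhedron by a level set of `m`. -/
def sectionFun (a : ι → V →L[ℝ] ℝ) (m : V →L[ℝ] ℝ) : ι ⊕ Fin 2 → V →L[ℝ] ℝ :=
  Sum.elim a ![m, -m]

/-- The bounds describing the section of a polyhedron by the level set `m = c`. -/
def sectionBound (b : ι → ℝ) (c : ℝ) : ι ⊕ Fin 2 → ℝ :=
  Sum.elim b ![c, -c]

variable {a : ι → V →L[ℝ] ℝ} {b : ι → ℝ} {m : V →L[ℝ] ℝ} {c : ℝ} {x : V}

theorem mem_polyhedron_section :
    x ∈ polyhedron (sectionFun a m) (sectionBound b c) ↔ x ∈ polyhedron a b ∧ m x = c := by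
  constructor
  · intro h
    refine ⟨fun i => h (Sum.inl i), le_antisymm (h (Sum.inr 0)) ?_⟩
    simpa [sectionFun, sectionBound] using h (Sum.inr 1)
  · rintro ⟨h, h'⟩ (i | i)
    · exact h i
    · fin_cases i <;> simp [sectionFun, sectionBound, h']

theorem active_section (hx : m x = c) {u : V} :
    (∀ i, sectionFun a m i x = sectionBound b c i → sectionFun a m i u = 0) ↔
      (∀ i, a i x = b i → a i u = 0) ∧ m u = 0 := by
  constructor
  · intro h
    exact ⟨fun i => h (Sum.inl i), h (Sum.inr 0) hx⟩
  · rintro ⟨h, h'⟩ (i | i)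
    · exact h i
    · fin_cases i <;> simp [sectionFun, h']

theorem mem_activeFace_section {y : V} :
    y ∈ activeFace (sectionFun a m) (sectionBound b c) x ↔ y ∈ activeFace a b x ∧ m y = c := by
  rw [activeFace, mem_sep_iff, mem_polyhedron_section]
  constructor
  · rintro ⟨⟨h1, h2⟩, h3⟩
    exact ⟨⟨h1, fun i => h3 (Sum.inl i)⟩, h2⟩
  · rintro ⟨⟨h1, h2⟩, h3⟩
    refine ⟨⟨h1, h3⟩, ?_⟩
    rintro (i | i)
    · exact h2 i
    · fin_cases i <;> simp [sectionFun, sectionBound, h3]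

end HyperplaneSection

/-! ### Edges of an edge-simple polytope -/

section Edges

variable {d : ℕ} {P : Set (EuclideanSpace ℝ (Fin (d + 1)))}

/-- Inequalities describing a full-dimensional polytope `P`, one for each facet. -/
structure FacetInequalities (a : Facet P → EuclideanSpace ℝ (Fin (d + 1)) →L[ℝ] ℝ)
    (b : Facet P → ℝ) : Prop where
  finite : Finite (Facet P)
  eq_polyhedron : P = polyhedron a b
  mem_facet_iff : ∀ F : Facet P, ∀ x ∈ P, x ∈ (F : Set _) ↔ a F x = b F

variable {a : Facet P → EuclideanSpace ℝ (Fin (d + 1)) →L[ℝ] ℝ} {b : Facet P → ℝ}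
  {lam : Facet P → SignedVector d} {x : EuclideanSpace ℝ (Fin (d + 1))}

/-- `d` facets `G i` of `P` which, together with the functional `m`, form a coordinate system and
whose vectors form a basis of `ℤᵈ`. -/
structure EdgeFrame (a : Facet P → EuclideanSpace ℝ (Fin (d + 1)) →L[ℝ] ℝ)
    (lam : Facet P → SignedVector d) (m : EuclideanSpace ℝ (Fin (d + 1)) →L[ℝ] ℝ)
    (G : Fin d → Facet P) : Prop where
  injective : Function.Injective G
  ker_eq_zero : ∀ u, (∀ i, a (G i) u = 0) → m u = 0 → u = 0
  isBasis : ∀ μ : Fin d → (Fin d → ℤ), (∀ i, SignedVector.mk (μ i) = lam (G i)) →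
      LinearIndependent ℤ μ ∧ Submodule.span ℤ (Set.range μ) = ⊤

theorem FacetInequalities.activeFace_subset_facet_iff (h : FacetInequalities a b) (hx : x ∈ P)
    (F : Facet P) : activeFace a b x ⊆ (F : Set _) ↔ x ∈ (F : Set _) := by
  have hx' : x ∈ polyhedron a b := h.eq_polyhedron ▸ hx
  refine ⟨fun hs => hs (self_mem_activeFace hx'), fun hxF y hy => ?_⟩
  exact (h.mem_facet_iff F y (h.eq_polyhedron.ge hy.1)).2
    (hy.2 F ((h.mem_facet_iff F x hx).1 hxF))

theorem FacetInequalities.isFace_activeFace (h : FacetInequalities a b) (hx : x ∈ P) :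
    IsFace P (activeFace a b x) := by
  have := h.finite
  have := _root_.isFace_activeFace (a := a) (b := b) (h.eq_polyhedron.le hx)
  rwa [← h.eq_polyhedron] at this

theorem FacetInequalities.eq_activeFace (h : FacetInequalities a b)
    {F : Set (EuclideanSpace ℝ (Fin (d + 1)))} (hF : IsFace P F) (hx : x ∈ intrinsicInterior ℝ F) :
    F = activeFace a b x := by
  have := h.finite
  exact eq_activeFace_of_mem_intrinsicInterior (h.eq_polyhedron ▸ hF.2) hx

/-- At a point where `m` takes a value which it takes at no vertex, there is an edge of the face of
the point along which `m` is not constant. -/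
theorem FacetInequalities.exists_edgeFrame (h : FacetInequalities a b) (hd : 1 ≤ d)
    (hP : IsEdgeSimplePolytope (d + 1) P) (hlam : IsIsotropyFunction P lam)
    (m : EuclideanSpace ℝ (Fin (d + 1)) →L[ℝ] ℝ) (hx : x ∈ P)
    (hm : ∀ v, IsVertex P v → m v ≠ m x) :
    ∃ G : Fin d → Facet P, EdgeFrame a lam m G ∧ ∀ F : Facet P, x ∈ (F : Set _) → F ∈ range G := by
  have := h.finite
  have hxa : x ∈ polyhedron a b := h.eq_polyhedron ▸ hx
  have hxR : x ∈ polyhedron (sectionFun a m) (sectionBound b (m x)) :=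
    mem_polyhedron_section.2 ⟨hxa, rfl⟩
  -- An extreme point of the slice of the face of `x` is extreme in the whole slice of `P`, so `m`
  -- and the functionals sharp there have no common kernel.
  obtain ⟨z, hz⟩ : ((activeFace (sectionFun a m) (sectionBound b (m x)) x).extremePoints ℝ).Nonempty :=
    IsCompact.extremePoints_nonempty
      (hP.isPolytope.isCompact.of_isClosed_subset isClosed_activeFace fun y hy => by
        rw [h.eq_polyhedron]
        exact (mem_polyhedron_section.1 hy.1).1) ⟨x, self_mem_activeFace hxR⟩
  have hzR := (isExposed_activeFace hxR).isExtreme.extremePoints_subset_extremePoints hz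
  obtain ⟨⟨hza, hzact⟩, hzm⟩ := mem_activeFace_section.1 hz.1
  have hker : ∀ u, (∀ F, a F z = b F → a F u = 0) → m u = 0 → u = 0 := fun u hu hmu =>
    eq_zero_of_mem_extremePoints hzR ((active_section hzm).2 ⟨hu, hmu⟩)
  have hzP : z ∈ P := h.eq_polyhedron ▸ hza
  have hFace := h.isFace_activeFace hzP
  -- The dimension is at most one since `m` is injective on the directions of the face, and not zero
  -- since `z` would be a vertex with a forbidden value of `m`.
  have hedge : IsEdge P (activeFace a b z) := by
    refine ⟨hFace, le_antisymm ?_ ?_⟩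
    · have := LinearMap.finrank_le_finrank_of_injective
        (f := m.toLinearMap.domRestrict (vectorSpan ℝ (activeFace a b z))) (by
          rw [injective_iff_map_eq_zero]
          rintro ⟨u, hu⟩ hmu
          exact Subtype.ext (hker u ((mem_vectorSpan_activeFace hza).1 hu) hmu))
      simpa [polyDim] using this
    · by_contra hlt
      have h0 : vectorSpan ℝ (activeFace a b z) = ⊥ := by
        rw [← Submodule.finrank_eq_zero (R := ℝ)]
        rw [polyDim] at hlt
        omega
      refine hm z ?_ hzm
      rw [IsVertex, ← activeFace_eq_singleton hza fun u hu => ?_]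
      · exact hFace
      · rw [← mem_vectorSpan_activeFace hza, h0] at hu
        simpa using hu
  have hcard : Nat.card {F : Facet P // z ∈ (F : Set _)} = d := by
    have h1 := hP.facets_at_edge _ hedge
    have h2 : {F | IsFacet P F ∧ activeFace a b z ⊆ F} =
        Subtype.val '' {F : Facet P | z ∈ (F : Set _)} := by
      ext F
      constructor
      · rintro ⟨hF, hs⟩
        exact ⟨⟨F, hF⟩, (h.activeFace_subset_facet_iff hzP ⟨F, hF⟩).1 hs, rfl⟩
      · rintro ⟨F, hF, rfl⟩
        exact ⟨F.2, (h.activeFace_subset_facet_iff hzP F).2 hF⟩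
    rw [h2, Set.ncard_image_of_injective _ Subtype.val_injective] at h1
    rw [← Nat.card_coe_set_eq] at h1
    exact Nat.succ_injective h1
  let e := Finite.equivFinOfCardEq hcard
  let G : Fin d → Facet P := fun i => (e.symm i).1
  have hG : ∀ F : Facet P, z ∈ (F : Set _) → F ∈ range G := fun F hF =>
    ⟨e ⟨F, hF⟩, by simp [G]⟩
  have hGinj : Function.Injective G := Subtype.val_injective.comp e.symm.injective
  refine ⟨G, ⟨hGinj, fun u hu => hker u fun F hF => ?_, ?_⟩, fun F hF => hG F ?_⟩
  · obtain ⟨i, rfl⟩ := hG F ((h.mem_facet_iff F z hzP).2 hF)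
    exact hu i
  · refine hlam G hGinj ?_
    convert hedge
    ext y
    rw [mem_iInter]
    constructor
    · intro hy
      -- Here `1 ≤ d` matters: an empty intersection of facets would not lie in `P`.
      have hyP : y ∈ P := (G ⟨0, hd⟩).2.1.subset (hy _)
      refine ⟨h.eq_polyhedron ▸ hyP, fun F hF => ?_⟩
      obtain ⟨i, rfl⟩ := hG F ((h.mem_facet_iff F z hzP).2 hF)
      exact (h.mem_facet_iff _ y hyP).1 (hy i)
    · intro hy i
      exact (h.activeFace_subset_facet_iff hzP (G i)).2 (e.symm i).2 hy
  · exact (h.mem_facet_iff F z hzP).2 (hzact F ((h.mem_facet_iff F x hx).1 hF))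

/-- The coordinate system given by a frame. -/
theorem EdgeFrame.exists_coordinates {m : EuclideanSpace ℝ (Fin (d + 1)) →L[ℝ] ℝ}
    {G : Fin d → Facet P} (hG : EdgeFrame a lam m G) :
    ∃ Λ : EuclideanSpace ℝ (Fin (d + 1)) ≃L[ℝ] (Fin d → ℝ) × ℝ,
      ∀ u, Λ u = (fun i => a (G i) u, m u) := by
  let f : EuclideanSpace ℝ (Fin (d + 1)) →ₗ[ℝ] (Fin d → ℝ) × ℝ :=
    (LinearMap.pi fun i => (a (G i)).toLinearMap).prod m.toLinearMap
  have hf : Function.Injective f := by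
    rw [injective_iff_map_eq_zero]
    intro u hu
    rw [Prod.ext_iff] at hu
    exact hG.ker_eq_zero u (fun i => congrFun hu.1 i) hu.2
  exact ⟨(LinearEquiv.ofInjectiveOfFinrankEq f hf (by simp)).toContinuousLinearEquiv, fun u => rfl⟩

theorem EdgeFrame.exists_direction {m : EuclideanSpace ℝ (Fin (d + 1)) →L[ℝ] ℝ}
    {G : Fin d → Facet P} (hG : EdgeFrame a lam m G) (s : Fin d → ℝ) :
    ∃ u, (∀ i, a (G i) u = s i) ∧ m u = 0 := by
  obtain ⟨Λ, hΛ⟩ := hG.exists_coordinates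
  have := hΛ (Λ.symm (s, 0))
  rw [Λ.apply_symm_apply, Prod.ext_iff] at this
  exact ⟨Λ.symm (s, 0), fun i => (congrFun this.1 i).symm, this.2.symm⟩

/-- The dimension of the faces of a section. -/
theorem FacetInequalities.polyDim_section (h : FacetInequalities a b)
    {m : EuclideanSpace ℝ (Fin (d + 1)) →L[ℝ] ℝ} {G : Fin d → Facet P} (hG : EdgeFrame a lam m G)
    (hx : x ∈ P) (hxG : ∀ F : Facet P, x ∈ (F : Set _) → F ∈ range G) :
    polyDim (activeFace (sectionFun a m) (sectionBound b (m x)) x) =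
      Nat.card {i // x ∉ (G i : Set _)} := by
  classical
  have := h.finite
  obtain ⟨Λ, hΛ⟩ := hG.exists_coordinates
  have hxR : x ∈ polyhedron (sectionFun a m) (sectionBound b (m x)) :=
    mem_polyhedron_section.2 ⟨h.eq_polyhedron ▸ hx, rfl⟩
  have hmem : ∀ u, u ∈ vectorSpan ℝ (activeFace (sectionFun a m) (sectionBound b (m x)) x) ↔
      (∀ i, x ∈ (G i : Set _) → (Λ u).1 i = 0) ∧ (Λ u).2 = 0 := by
    intro u
    rw [mem_vectorSpan_activeFace hxR, active_section rfl, hΛ]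
    refine and_congr_left fun _ => ⟨fun hu i hi => hu _ ((h.mem_facet_iff _ x hx).1 hi),
      fun hu F hF => ?_⟩
    have hF := (h.mem_facet_iff _ x hx).2 hF
    obtain ⟨i, rfl⟩ := hxG F hF
    exact hu i hF
  -- In frame coordinates the directions of the face are the vectors supported on the indices of the
  -- facets missing `x`; extension by zero parametrizes them.
  let f : ({i // x ∉ (G i : Set _)} → ℝ) →ₗ[ℝ] EuclideanSpace ℝ (Fin (d + 1)) :=
    Λ.symm.toLinearMap ∘ₗ LinearMap.inl ℝ (Fin d → ℝ) ℝ ∘ₗ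
      Function.ExtendByZero.linearMap ℝ (Subtype.val : {i // x ∉ (G i : Set _)} → Fin d)
  have hf : ∀ s, Λ (f s) = (Function.extend Subtype.val s 0, 0) := by
    intro s
    change Λ (Λ.symm _) = _
    rw [Λ.apply_symm_apply]
    rfl
  have hinj : Function.Injective f := by
    intro s s' hs
    have h1 := hf s
    rw [hs, hf s', Prod.ext_iff] at h1
    exact (Function.extend_injective Subtype.val_injective (0 : Fin d → ℝ) h1.1).symm
  have hrange : LinearMap.range f =
      vectorSpan ℝ (activeFace (sectionFun a m) (sectionBound b (m x)) x) := by
    ext u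
    rw [hmem, LinearMap.mem_range]
    constructor
    · rintro ⟨s, rfl⟩
      rw [hf]
      refine ⟨fun i hi => Function.extend_apply' _ _ _ ?_, rfl⟩
      rintro ⟨⟨j, hj⟩, rfl⟩
      exact hj hi
    · rintro ⟨hu, hu'⟩
      refine ⟨fun i => (Λ u).1 i, Λ.injective ?_⟩
      rw [hf]
      refine Prod.ext (funext fun i => ?_) hu'.symm
      change Function.extend Subtype.val (fun i : {i // x ∉ (G i : Set _)} => (Λ u).1 i.1) 0 i = _
      by_cases hi : x ∈ (G i : Set _)
      · rw [Function.extend_apply' _ _ _ (by rintro ⟨⟨j, hj⟩, rfl⟩; exact hj hi), hu i hi]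
        rfl
      · exact Subtype.val_injective.extend_apply _ _ (⟨i, hi⟩ : {i // x ∉ (G i : Set _)})
  rw [polyDim, ← hrange, LinearMap.finrank_range_of_inj hinj, Module.finrank_pi,
    Nat.card_eq_fintype_card]

end Edges

/-! ### The truncation facets -/

section CutFacets

variable {d : ℕ} {P : Set (EuclideanSpace ℝ (Fin (d + 1)))}
  {a : Facet P → EuclideanSpace ℝ (Fin (d + 1)) →L[ℝ] ℝ} {b : Facet P → ℝ}
  {lam : Facet P → SignedVector d}

theorem IsPolytope.finite_vertex {n : ℕ} {P : Set (EuclideanSpace ℝ (Fin n))} (hP : IsPolytope P) :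
    Finite (Vertex P) := by
  obtain ⟨s, -, rfl⟩ := hP
  refine Set.Finite.to_subtype (s := {v | IsVertex (convexHull ℝ (s : Set (EuclideanSpace ℝ (Fin n)))) v}) ?_
  exact s.finite_toSet.subset fun v hv => extremePoints_convexHull_subset hv.mem_extremePoints

theorem FacetInequalities.convexHull_vertices (h : FacetInequalities a b) (hP : IsPolytope P) :
    convexHull ℝ {v | IsVertex P v} = P := by
  have := h.finite
  have hPa := h.eq_polyhedron
  have h1 : {v | IsVertex P v} = (polyhedron a b).extremePoints ℝ := by
    ext v
    have := isVertex_iff_mem_extremePoints (a := a) (b := b) (v := v)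
    rwa [← hPa] at this ⊢
  rw [h1, convexHull_extremePoints_polyhedron (hPa ▸ hP.isCompact), ← hPa]

/-- Otherwise `P` would lie in a segment, against dimension at least two. -/
theorem FacetInequalities.exists_third_vertex (h : FacetInequalities a b) (hd : 1 ≤ d)
    (hP : IsPolytope P) (hdim : polyDim P = d + 1) (v w : EuclideanSpace ℝ (Fin (d + 1))) :
    ∃ u, IsVertex P u ∧ u ≠ v ∧ u ≠ w := by
  by_contra! hno
  have h1 : P ⊆ convexHull ℝ {v, w} := by
    rw [← h.convexHull_vertices hP]
    refine convexHull_mono fun u hu => ?_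
    by_cases huv : u = v
    · simp [huv]
    · simp [hno u hu huv]
  rw [convexHull_pair] at h1
  have h2 := vectorSpan_mono ℝ h1
  rw [vectorSpan_segment] at h2
  have h3 := (Submodule.finrank_mono h2).trans (finrank_span_le_card _)
  rw [toFinset_singleton, Finset.card_singleton] at h3
  rw [polyDim] at hdim
  omega

namespace VertexTruncation

/-- The closed cap cut off at one vertex is disjoint from the closed caps at other vertices. -/
theorem normal_lt_of_le (H : VertexTruncation P) (h : FacetInequalities a b) (hd : 1 ≤ d)
    (hP : IsPolytope P) (hdim : polyDim P = d + 1) {v w : Vertex P} (hvw : w ≠ v)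
    {x : EuclideanSpace ℝ (Fin (d + 1))} (hx : x ∈ P) (hxv : H.height v ≤ H.normal v x) :
    H.normal w x < H.height w := by
  -- a point of the section at `v` on the right side of the hyperplane at `w`
  obtain ⟨u, hu, huv, huw⟩ := h.exists_third_vertex hd hP hdim v w
  obtain ⟨t, ht0, ht1, ht⟩ := exists_mem_segment_eq
    (H.lt_height v ⟨u, hu⟩ fun e => huv (congrArg Subtype.val e)) (H.height_lt v)
  have hz : ∃ z ∈ P, H.normal v z = H.height v ∧ H.normal w z < H.height w := by
    refine ⟨_, hP.convex.add_smul_sub_mem hu.mem v.2.mem ⟨ht0.le, ht1.le⟩, ht, ?_⟩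
    have h1 := H.lt_height w ⟨u, hu⟩ fun e => huw (congrArg Subtype.val e)
    have h2 := H.lt_height w v hvw.symm
    simp only [map_add, map_smul, map_sub, smul_eq_mul] at h1 h2 ⊢
    nlinarith
  obtain ⟨z, hzP, hzv, hzw⟩ := hz
  -- The section at `v` is convex and does not meet the hyperplane of `w`, so it stays on the side
  -- of the point found above.
  have hsec : ∀ y ∈ P, H.normal v y = H.height v → H.normal w y < H.height w := by
    intro y hy hyv
    by_contra! hyw
    have hdis := fun y => Set.eq_empty_iff_forall_notMem.1 (H.disjoint v w hvw.symm) y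
    rcases hyw.eq_or_lt with hyw | hyw
    · exact hdis y ⟨⟨hyv, hyw.symm⟩, hy⟩
    · obtain ⟨s, hs0, hs1, hs⟩ := exists_mem_segment_eq hzw hyw
      refine hdis _ ⟨⟨?_, hs⟩, hP.convex.add_smul_sub_mem hzP hy ⟨hs0.le, hs1.le⟩⟩
      simp [hzv, hyv]
  have hx' := hx
  rw [← h.convexHull_vertices hP] at hx'
  have hins : {v | IsVertex P v} = insert v.1 {u | IsVertex P u ∧ u ≠ v.1} := by
    ext u
    simp only [mem_insert_iff, mem_ofPred_eq]
    by_cases huv : u = v.1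
    · simp [huv, v.2]
    · simp [huv]
  -- Write `x` on a segment from a point `y` of the hull of the other vertices to `v`. Such a `y`
  -- lies outside the cap, so the segment enters the cap at a parameter `s` no larger than that of
  -- `x`.
  rw [hins, convexHull_insert (s := {u | IsVertex P u ∧ u ≠ v.1}) ⟨u, hu, huv⟩, mem_convexJoin] at hx'
  obtain ⟨_, rfl, y, hy, hxy⟩ := hx'
  have hyP : y ∈ P := by
    rw [← h.convexHull_vertices hP]
    exact convexHull_mono (fun u hu => hu.1) hy
  have hyv : H.normal v y < H.height v := by
    have hc : Convex ℝ {y | H.normal v y < H.height v} :=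
      convex_halfSpace_lt (H.normal v).isLinear _
    exact convexHull_min (fun u hu => H.lt_height v ⟨u, hu.1⟩ fun e => hu.2 (congrArg Subtype.val e))
      hc hy
  obtain ⟨s, hs0, hs1, hs⟩ := exists_mem_segment_eq hyv (H.height_lt v)
  have h1 := hsec _ (hP.convex.add_smul_sub_mem hyP v.2.mem ⟨hs0.le, hs1.le⟩) hs
  have h2 := H.lt_height w v hvw.symm
  have h3 := H.height_lt v
  rw [segment_symm, segment_eq_image'] at hxy
  obtain ⟨r, ⟨hr0, hr1⟩, rfl⟩ := hxy
  simp only [map_add, map_smul, map_sub, smul_eq_mul] at h1 h2 hs hxv ⊢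
  have hrs : s ≤ r := by
    by_contra! hlt
    nlinarith
  by_contra! hcon
  rcases hr1.eq_or_lt with rfl | hr1
  · linarith
  -- The point `x` lies between the crossing at `s` and the vertex `v`, and at both the functional
  -- of `w` is below its height.
  · have e1 := mul_pos (sub_pos.2 hr1) (sub_pos.2 h1)
    have e2 := mul_nonneg (sub_nonneg.2 hrs) (sub_pos.2 h2).le
    have e3 := mul_nonneg (sub_pos.2 hs1).le (sub_nonneg.2 hcon)
    nlinarith

/-- Since closed caps are disjoint, the constraints of the other cuts hold automatically on this
hyperplane section. -/
theorem cutFacet_eq (H : VertexTruncation P) (h : FacetInequalities a b) (hd : 1 ≤ d)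
    (hP : IsPolytope P) (hdim : polyDim P = d + 1) (v : Vertex P) :
    H.cutFacet v = {x ∈ P | H.normal v x = H.height v} := by
  ext x
  constructor
  · rintro ⟨h1, h2, h3⟩
    exact ⟨h2, h1⟩
  · rintro ⟨h1, h2⟩
    refine ⟨h2, h1, fun w => ?_⟩
    by_cases hw : w = v
    · rw [hw, h2]
    · exact (H.normal_lt_of_le h hd hP hdim hw h1 h2.ge).le

theorem not_isVertex_of_mem (H : VertexTruncation P) {x : EuclideanSpace ℝ (Fin (d + 1))}
    (hx : x ∈ H.truncation) : ¬ IsVertex P x := fun hv =>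
  (hx.2 ⟨x, hv⟩).not_gt (H.height_lt ⟨x, hv⟩)

/-- This is the genericity that allows the normal of the cut to be the last coordinate of a frame.
-/
theorem normal_ne_of_isVertex (H : VertexTruncation P) (v : Vertex P)
    {w : EuclideanSpace ℝ (Fin (d + 1))} (hw : IsVertex P w) : H.normal v w ≠ H.height v := by
  by_cases h : w = v
  · rw [h]
    exact (H.height_lt v).ne'
  · exact (H.lt_height v ⟨w, hw⟩ fun e => h (congrArg Subtype.val e)).ne

theorem isClosed_truncation (H : VertexTruncation P) (hP : IsPolytope P) :
    IsClosed H.truncation := by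
  have : H.truncation = P ∩ ⋂ v, {x | H.normal v x ≤ H.height v} := by
    ext; simp [truncation]
  rw [this]
  exact hP.isCompact.isClosed.inter <| isClosed_iInter fun v =>
    isClosed_le (H.normal v).continuous continuous_const

theorem isCompact_truncation (H : VertexTruncation P) (hP : IsPolytope P) :
    IsCompact H.truncation :=
  hP.isCompact.of_isClosed_subset (H.isClosed_truncation hP) fun _ hx => hx.1

theorem isCompact_cutFacet (H : VertexTruncation P) (hP : IsPolytope P) (v : Vertex P) :
    IsCompact (H.cutFacet v) :=
  (H.isCompact_truncation hP).inter_left (isClosed_eq (H.normal v).continuous continuous_const)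

/-- The truncation facet as a polyhedron. -/
theorem cutFacet_eq_polyhedron (H : VertexTruncation P) (h : FacetInequalities a b) (hd : 1 ≤ d)
    (hP : IsPolytope P) (hdim : polyDim P = d + 1) (v : Vertex P) :
    H.cutFacet v = polyhedron (sectionFun a (H.normal v)) (sectionBound b (H.height v)) := by
  rw [H.cutFacet_eq h hd hP hdim]
  ext x
  rw [mem_polyhedron_section, ← h.eq_polyhedron]
  rfl

theorem exists_edgeFrame_cutFacet (H : VertexTruncation P) (h : FacetInequalities a b) (hd : 1 ≤ d)
    (hP : IsEdgeSimplePolytope (d + 1) P) (hlam : IsIsotropyFunction P lam) {v : Vertex P}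
    {x : EuclideanSpace ℝ (Fin (d + 1))} (hx : x ∈ H.cutFacet v) :
    ∃ G : Fin d → Facet P, EdgeFrame a lam (H.normal v) G ∧
      ∀ F : Facet P, x ∈ (F : Set _) → F ∈ range G := by
  refine h.exists_edgeFrame hd hP hlam (H.normal v) hx.2.1 fun w hw => ?_
  rw [show H.normal v x = H.height v from hx.1]
  exact H.normal_ne_of_isVertex v hw

/-- The face of the truncation facet with a given point in its relative interior. -/
theorem eq_activeFace_cutFacet (H : VertexTruncation P) (h : FacetInequalities a b) (hd : 1 ≤ d)
    (hP : IsPolytope P) (hdim : polyDim P = d + 1) {v : Vertex P}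
    {F : Set (EuclideanSpace ℝ (Fin (d + 1)))} (hF : IsFace (H.cutFacet v) F)
    {x : EuclideanSpace ℝ (Fin (d + 1))} (hx : x ∈ intrinsicInterior ℝ F) :
    F = activeFace (sectionFun a (H.normal v)) (sectionBound b (H.height v)) x := by
  have := h.finite
  have h1 := hF.2
  rw [H.cutFacet_eq_polyhedron h hd hP hdim] at h1
  exact eq_activeFace_of_mem_intrinsicInterior h1 hx

theorem isFace_activeFace_cutFacet (H : VertexTruncation P) (h : FacetInequalities a b)
    (hd : 1 ≤ d) (hP : IsPolytope P) (hdim : polyDim P = d + 1) {v : Vertex P}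
    {x : EuclideanSpace ℝ (Fin (d + 1))} (hx : x ∈ H.cutFacet v) :
    IsFace (H.cutFacet v)
      (activeFace (sectionFun a (H.normal v)) (sectionBound b (H.height v)) x) := by
  have := h.finite
  rw [H.cutFacet_eq_polyhedron h hd hP hdim] at hx ⊢
  exact isFace_activeFace hx

theorem mem_intrinsicInterior_cutFacet (H : VertexTruncation P) (h : FacetInequalities a b)
    (hd : 1 ≤ d) (hP : IsPolytope P) (hdim : polyDim P = d + 1) {v : Vertex P}
    {x : EuclideanSpace ℝ (Fin (d + 1))} (hx : x ∈ H.cutFacet v) :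
    x ∈ intrinsicInterior ℝ
      (activeFace (sectionFun a (H.normal v)) (sectionBound b (H.height v)) x) := by
  have := h.finite
  rw [H.cutFacet_eq_polyhedron h hd hP hdim] at hx
  exact mem_intrinsicInterior_activeFace hx

theorem polyDim_activeFace_cutFacet (H : VertexTruncation P) (h : FacetInequalities a b)
    {v : Vertex P} {x : EuclideanSpace ℝ (Fin (d + 1))} (hx : x ∈ H.cutFacet v)
    {G : Fin d → Facet P} (hG : EdgeFrame a lam (H.normal v) G)
    (hxG : ∀ F : Facet P, x ∈ (F : Set _) → F ∈ range G) :
    polyDim (activeFace (sectionFun a (H.normal v)) (sectionBound b (H.height v)) x) =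
      Nat.card {i // x ∉ (G i : Set _)} := by
  have := h.polyDim_section hG hx.2.1 hxG
  rwa [show H.normal v x = H.height v from hx.1] at this

/-- From a point of the truncation facet one may move away from any set of facets of `P`. -/
theorem exists_mem_cutFacet (H : VertexTruncation P) (h : FacetInequalities a b) (hd : 1 ≤ d)
    (hP : IsPolytope P) (hdim : polyDim P = d + 1) {v : Vertex P}
    {x : EuclideanSpace ℝ (Fin (d + 1))} (hx : x ∈ H.cutFacet v)
    {G : Fin d → Facet P} (hG : EdgeFrame a lam (H.normal v) G)
    (hxG : ∀ F : Facet P, x ∈ (F : Set _) → F ∈ range G) (A : Set (Fin d)) :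
    ∃ y ∈ H.cutFacet v, ∀ F : Facet P,
      y ∈ (F : Set _) ↔ x ∈ (F : Set _) ∧ ∃ i ∈ A, G i = F := by
  classical
  have := h.finite
  obtain ⟨u, hu, hmu⟩ := hG.exists_direction fun i => if i ∈ A then 0 else -1
  have hxa : x ∈ polyhedron a b := h.eq_polyhedron.le hx.2.1
  have hxu : ∀ F, a F x = b F → a F u ≤ 0 := by
    intro F hF
    obtain ⟨i, rfl⟩ := hxG F ((h.mem_facet_iff F x hx.2.1).2 hF)
    rw [hu]
    split_ifs <;> norm_num
  obtain ⟨ε, hε, hmem, hact⟩ := exists_active hxa hxu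
  have hyP : x + ε • u ∈ P := h.eq_polyhedron.ge hmem
  refine ⟨x + ε • u, ?_, fun F => ?_⟩
  · rw [H.cutFacet_eq h hd hP hdim]
    refine ⟨hyP, ?_⟩
    rw [map_add, map_smul, hmu, smul_zero, add_zero]
    exact hx.1
  · rw [h.mem_facet_iff F _ hyP, hact, h.mem_facet_iff F x hx.2.1]
    refine and_congr_right fun hF => ?_
    obtain ⟨i, rfl⟩ := hxG F ((h.mem_facet_iff F x hx.2.1).2 hF)
    rw [hu]
    constructor
    · intro hi
      refine ⟨i, ?_, rfl⟩
      by_contra hA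
      rw [if_neg hA] at hi
      norm_num at hi
    · rintro ⟨j, hj, hji⟩
      rw [← hG.injective hji, if_pos hj]

theorem cutFacet_nonempty (H : VertexTruncation P) (h : FacetInequalities a b) (hd : 1 ≤ d)
    (hP : IsPolytope P) (hdim : polyDim P = d + 1) (v : Vertex P) : (H.cutFacet v).Nonempty := by
  obtain ⟨u, hu, huv, -⟩ := h.exists_third_vertex hd hP hdim v v
  obtain ⟨t, ht0, ht1, ht⟩ := exists_mem_segment_eq
    (H.lt_height v ⟨u, hu⟩ fun e => huv (congrArg Subtype.val e)) (H.height_lt v)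
  rw [H.cutFacet_eq h hd hP hdim]
  exact ⟨_, hP.convex.add_smul_sub_mem hu.mem v.2.mem ⟨ht0.le, ht1.le⟩, ht⟩

/-- Moving away from all the frame facets reaches a point of the section on no facet of `P`; its
face is the whole section, and none of the d frame facets is lost in the count. -/
theorem polyDim_cutFacet (H : VertexTruncation P) (h : FacetInequalities a b) (hd : 1 ≤ d)
    (hP : IsEdgeSimplePolytope (d + 1) P) (hlam : IsIsotropyFunction P lam) (v : Vertex P) :
    polyDim (H.cutFacet v) = d := by
  have hP' := hP.isPolytope
  have hdim := hP.dim_eq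
  obtain ⟨x, hx⟩ := H.cutFacet_nonempty h hd hP' hdim v
  obtain ⟨G, hG, hxG⟩ := H.exists_edgeFrame_cutFacet h hd hP hlam hx
  obtain ⟨y, hy, hyF⟩ := H.exists_mem_cutFacet h hd hP' hdim hx hG hxG ∅
  have hyF : ∀ F : Facet P, y ∉ (F : Set _) := fun F => by simp [hyF]
  have h1 := H.polyDim_activeFace_cutFacet h hy hG fun F hF => absurd hF (hyF F)
  have h2 : activeFace (sectionFun a (H.normal v)) (sectionBound b (H.height v)) y =
      H.cutFacet v := by
    ext z
    rw [mem_activeFace_section, H.cutFacet_eq h hd hP' hdim, activeFace, ← h.eq_polyhedron]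
    refine and_congr_left fun _ => and_iff_left fun F hF => ?_
    exact absurd ((h.mem_facet_iff F y hy.2.1).2 hF) (hyF F)
  rw [← h2, h1]
  simp [hyF]

/-- The face of the truncation facet cut out by a facet of `P`. -/
theorem activeFace_cutFacet_of_unique (H : VertexTruncation P) (h : FacetInequalities a b)
    (hd : 1 ≤ d) (hP : IsPolytope P) (hdim : polyDim P = d + 1) {v : Vertex P}
    {y : EuclideanSpace ℝ (Fin (d + 1))} (hy : y ∈ H.cutFacet v) {F : Facet P}
    (hyF : ∀ F' : Facet P, y ∈ (F' : Set _) ↔ F' = F) :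
    activeFace (sectionFun a (H.normal v)) (sectionBound b (H.height v)) y =
      F.1 ∩ H.cutFacet v := by
  ext z
  rw [mem_activeFace_section, H.cutFacet_eq h hd hP hdim, activeFace, ← h.eq_polyhedron]
  constructor
  · rintro ⟨⟨hz, hzF⟩, hzm⟩
    exact ⟨(h.mem_facet_iff F z hz).2 (hzF F ((h.mem_facet_iff F y hy.2.1).1 ((hyF F).2 rfl))),
      hz, hzm⟩
  · rintro ⟨hzF, hz, hzm⟩
    refine ⟨⟨hz, fun F' hF' => ?_⟩, hzm⟩
    rw [(hyF F').1 ((h.mem_facet_iff F' y hy.2.1).2 hF')]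
    exact (h.mem_facet_iff F z hz).1 hzF

/-- At a vertex of the section all d frame facets are sharp. Their traces are distinct facets of the
section, and every facet of the section through that vertex is one of these traces. -/
theorem isSimplePolytope_cutFacet (H : VertexTruncation P) (h : FacetInequalities a b) (hd : 1 ≤ d)
    (hP : IsEdgeSimplePolytope (d + 1) P) (hlam : IsIsotropyFunction P lam) (v : Vertex P) :
    IsSimplePolytope d (H.cutFacet v) := by
  have := h.finite
  have hP' := hP.isPolytope
  have hdim := hP.dim_eq
  have hpoly := H.cutFacet_eq_polyhedron h hd hP' hdim v
  refine ⟨?_, H.polyDim_cutFacet h hd hP hlam v, fun x hx => ?_⟩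
  · have h1 := H.isCompact_cutFacet hP' v
    have h2 := H.cutFacet_nonempty h hd hP' hdim v
    rw [hpoly] at h1 h2 ⊢
    exact isPolytope_polyhedron h1 h2
  · have hxR := hx.mem
    obtain ⟨G, hG, hxG⟩ := H.exists_edgeFrame_cutFacet h hd hP hlam hxR
    -- all the facets of the frame pass through the vertex
    have hall : ∀ i, x ∈ (G i : Set _) := by
      have h1 := H.polyDim_activeFace_cutFacet h hxR hG hxG
      have h2 : activeFace (sectionFun a (H.normal v)) (sectionBound b (H.height v)) x = {x} := by
        refine (H.eq_activeFace_cutFacet h hd hP' hdim hx ?_).symm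
        simp
      rw [h2, polyDim, vectorSpan_singleton, finrank_bot] at h1
      have h3 := (Finite.card_eq_zero_iff).1 h1.symm
      intro i
      by_contra hi
      exact h3.false ⟨i, hi⟩
    have hset : {F | IsFacet (H.cutFacet v) F ∧ x ∈ F} =
        range fun i => (G i : Set _) ∩ H.cutFacet v := by
      ext F
      constructor
      · rintro ⟨⟨hF, hFdim⟩, hxF⟩
        obtain ⟨p, hp⟩ := hF.1.intrinsicInterior (hF.convex (hpoly ▸ convex_polyhedron))
        have hpR := hF.subset (intrinsicInterior_subset hp)
        have hFp := H.eq_activeFace_cutFacet h hd hP' hdim hF hp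
        obtain ⟨G', hG', hpG'⟩ := H.exists_edgeFrame_cutFacet h hd hP hlam hpR
        have h1 := H.polyDim_activeFace_cutFacet h hpR hG' hpG'
        rw [← hFp] at h1
        rw [H.polyDim_cutFacet h hd hP hlam, h1] at hFdim
        -- Codimension one means that exactly one of the d frame facets passes through the relative
        -- interior point `p`, so `F` is the trace of a single facet of `P`.
        have h2 : Nat.card {i // p ∈ (G' i : Set _)} = 1 := by
          classical
          have h3 := Nat.card_congr (Equiv.sumCompl fun i => p ∈ (G' i : Set _))
          rw [Nat.card_sum, Nat.card_fin] at h3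
          omega
        obtain ⟨⟨j, hj⟩, hju⟩ := (Nat.card_eq_one_iff_exists).1 h2
        have hpu : ∀ F' : Facet P, p ∈ (F' : Set _) ↔ F' = G' j := by
          intro F'
          constructor
          · intro hF'
            obtain ⟨i, rfl⟩ := hpG' F' hF'
            exact congrArg G' (congrArg Subtype.val (hju ⟨i, hF'⟩))
          · rintro rfl
            exact hj
        rw [H.activeFace_cutFacet_of_unique h hd hP' hdim hpR hpu] at hFp
        rw [hFp] at hxF
        obtain ⟨i, hi⟩ := hxG _ hxF.1
        exact ⟨i, by simp only [hi, hFp]⟩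
      · rintro ⟨i, rfl⟩
        -- Leaving all frame facets except `G i` gives a relative interior point of the trace of `G
        -- i`.
        obtain ⟨y, hy, hyF⟩ := H.exists_mem_cutFacet h hd hP' hdim hxR hG hxG {i}
        have hyu : ∀ F' : Facet P, y ∈ (F' : Set _) ↔ F' = G i := by
          intro F'
          rw [hyF]
          constructor
          · rintro ⟨-, j, rfl, rfl⟩
            rfl
          · rintro rfl
            exact ⟨hall i, i, rfl, rfl⟩
        have h1 := H.activeFace_cutFacet_of_unique h hd hP' hdim hy hyu
        refine ⟨⟨?_, ?_⟩, hall i, hxR⟩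
        · simp only
          rw [← h1]
          exact H.isFace_activeFace_cutFacet h hd hP' hdim hy
        · simp only
          rw [← h1, H.polyDim_activeFace_cutFacet h hy hG fun F' hF' => ⟨i, ((hyu F').1 hF').symm⟩,
            H.polyDim_cutFacet h hd hP hlam]
          have h2 : Nat.card {j // y ∈ (G j : Set _)} = 1 := by
            rw [Nat.card_eq_one_iff_exists]
            refine ⟨⟨i, (hyu _).2 rfl⟩, fun ⟨j, hj⟩ => Subtype.ext (hG.injective ((hyu _).1 hj))⟩
          classical
          have h3 := Nat.card_congr (Equiv.sumCompl fun j => y ∈ (G j : Set _))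
          rw [Nat.card_sum, Nat.card_fin] at h3
          omega
    have hinj : Function.Injective fun i => (G i : Set _) ∩ H.cutFacet v := by
      intro i j hij
      obtain ⟨y, hy, hyF⟩ := H.exists_mem_cutFacet h hd hP' hdim hxR hG hxG {i}
      have h1 : y ∈ (G j : Set _) ∩ H.cutFacet v := by
        rw [← show (G i : Set _) ∩ H.cutFacet v = (G j : Set _) ∩ H.cutFacet v from hij]
        exact ⟨(hyF _).2 ⟨hall i, i, rfl, rfl⟩, hy⟩
      obtain ⟨-, k, rfl, hk⟩ := (hyF _).1 h1.1
      exact hG.injective hk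
    rw [hset, ← Nat.card_coe_set_eq, Nat.card_range_of_injective hinj, Nat.card_fin]

end VertexTruncation

end CutFacets

/-! ### Automorphisms of the torus and face tori -/

section TorusAutomorphisms

variable {d : ℕ}

/-- The endomorphism of the torus given by an integer matrix. -/
noncomputable def torusEnd (A : Matrix (Fin d) (Fin d) ℤ) : Torus d →* Torus d where
  toFun t k := ∏ i, t i ^ A i k
  map_one' := by funext k; simp
  map_mul' s t := by funext k; simp [mul_zpow, Finset.prod_mul_distrib]

theorem torusEnd_apply (A : Matrix (Fin d) (Fin d) ℤ) (t : Torus d) (k : Fin d) :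
    torusEnd A t k = ∏ i, t i ^ A i k := rfl

theorem continuous_torusEnd (A : Matrix (Fin d) (Fin d) ℤ) : Continuous (torusEnd A) := by
  refine continuous_pi fun k => ?_
  simp only [torusEnd_apply]
  fun_prop

/-- The exponents follow the row vector convention, so applying `A` first gives the product `A * B`.
-/
theorem torusEnd_torusEnd (A B : Matrix (Fin d) (Fin d) ℤ) (t : Torus d) :
    torusEnd B (torusEnd A t) = torusEnd (A * B) t := by
  funext l
  simp only [torusEnd_apply, Matrix.mul_apply, ← Finset.prod_zpow]
  rw [Finset.prod_comm]
  refine Finset.prod_congr rfl fun i _ => ?_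
  simp only [← zpow_mul]
  induction (Finset.univ : Finset (Fin d)) using Finset.induction_on with
  | empty => simp
  | insert j s hj ih => rw [Finset.prod_insert hj, Finset.sum_insert hj, ih, zpow_add]

theorem torusEnd_one (t : Torus d) : torusEnd 1 t = t := by
  funext k
  rw [torusEnd_apply, Finset.prod_eq_single k]
  · simp
  · intro i _ hi
    simp [Matrix.one_apply_ne hi]
  · simp

theorem Circle.exp_sum {ι : Type*} (s : Finset ι) (f : ι → ℝ) :
    Circle.exp (∑ i ∈ s, f i) = ∏ i ∈ s, Circle.exp (f i) := by
  classical
  induction s using Finset.induction_on with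
  | empty => simp
  | insert j s hj ih => rw [Finset.sum_insert hj, Finset.prod_insert hj, Circle.exp_add, ih]

theorem Circle.exp_mul_intCast (x : ℝ) (n : ℤ) : Circle.exp (x * n) = Circle.exp x ^ n := by
  rw [← Circle.exp_intCast_mul, mul_comm]

theorem torusEnd_exp (A : Matrix (Fin d) (Fin d) ℤ) (c : Fin d → ℝ) :
    torusEnd A (fun i => Circle.exp (2 * Real.pi * c i)) =
      fun k => Circle.exp (2 * Real.pi * ∑ i, c i * A i k) := by
  funext k
  rw [torusEnd_apply, Finset.mul_sum, Circle.exp_sum]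
  refine Finset.prod_congr rfl fun i _ => ?_
  rw [← mul_assoc, Circle.exp_mul_intCast]

/-- A basis of `ℤᵈ` gives an automorphism of the torus. -/
theorem exists_torus_automorphism {μ : Fin d → Fin d → ℤ}
    (hμ : Submodule.span ℤ (range μ) = ⊤) :
    ∃ δ : Torus d ≃ₜ* Torus d, ∀ c : Fin d → ℝ,
      δ.symm (fun i => Circle.exp (2 * Real.pi * c i)) =
        fun k => Circle.exp (2 * Real.pi * ∑ i, c i * μ i k) := by
  have h : ∀ k, ∃ c : Fin d → ℤ, ∑ i, c i • μ i = Pi.single k 1 := fun k =>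
    (Submodule.mem_span_range_iff_exists_fun ℤ).1 (hμ ▸ Submodule.mem_top)
  -- Spanning supplies an integral left inverse of the matrix with rows `μ i`; for square matrices
  -- it is two-sided.
  choose B hB using h
  let A : Matrix (Fin d) (Fin d) ℤ := Matrix.of μ
  have hBA : Matrix.of B * A = 1 := by
    ext k l
    have := congrFun (hB k) l
    simp only [Finset.sum_apply, Pi.smul_apply, smul_eq_mul] at this
    rw [Matrix.mul_apply, Matrix.one_apply]
    simp only [Matrix.of_apply, A]
    rw [this, Pi.single_apply]
    simp only [eq_comm]
  have hAB : A * Matrix.of B = 1 := mul_eq_one_comm.1 hBA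
  let δ : Torus d ≃ₜ* Torus d :=
    { toFun := torusEnd (Matrix.of B)
      invFun := torusEnd A
      left_inv := fun t => by rw [torusEnd_torusEnd, hBA, torusEnd_one]
      right_inv := fun t => by rw [torusEnd_torusEnd, hAB, torusEnd_one]
      map_mul' := map_mul _
      continuous_toFun := continuous_torusEnd _
      continuous_invFun := continuous_torusEnd _ }
  exact ⟨δ, fun c => torusEnd_exp A c⟩

/-- The principal argument is used so that trivial coordinates have logarithm exactly zero, not just
an integer. -/
theorem exists_torus_exp (t : Torus d) :
    ∃ c : Fin d → ℝ, (t = fun i => Circle.exp (2 * Real.pi * c i)) ∧ ∀ i, t i = 1 → c i = 0 := by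
  refine ⟨fun i => Complex.arg (t i) / (2 * Real.pi), funext fun i => ?_, fun i hi => ?_⟩
  · rw [mul_div_cancel₀ _ (by positivity), Circle.exp_arg]
  · simp [hi]

/-- Membership in the torus of a submodule generated, up to signs, by part of a basis. -/
theorem mem_subtorus_span_iff {μ : Fin d → Fin d → ℤ} {δ : Torus d ≃ₜ* Torus d}
    (hδ : ∀ c : Fin d → ℝ, δ.symm (fun i => Circle.exp (2 * Real.pi * c i)) =
        fun k => Circle.exp (2 * Real.pi * ∑ i, c i * μ i k))
    {I : Set (Fin d)} {A : Set (Fin d → ℤ)}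
    (hA : ∀ ν ∈ A, ∃ i ∈ I, SignedVector.mk ν = SignedVector.mk (μ i))
    (hI : ∀ i ∈ I, μ i ∈ A) (t : Torus d) :
    t ∈ subtorus (Submodule.span ℤ A) ↔ ∀ i, i ∉ I → δ t i = 1 := by
  constructor
  · rintro ⟨w, hw, rfl⟩
    -- Coordinates in the basis supported on `I`: first for the integral span, where the sign
    -- ambiguity enters as a unit coefficient, then for the real span.
    have hc : ∃ c : Fin d → ℝ, (∀ i, i ∉ I → c i = 0) ∧ ∀ k, w k = ∑ i, c i * μ i k := by
      have hint : ∀ v ∈ Submodule.span ℤ A,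
          ∃ c : Fin d → ℝ, (∀ i, i ∉ I → c i = 0) ∧ ∀ k, (v k : ℝ) = ∑ i, c i * μ i k := by
        intro v hv
        induction hv using Submodule.span_induction with
        | mem ν hν =>
          obtain ⟨i, hi, h⟩ := hA ν hν
          obtain ⟨u, hu⟩ := MulAction.orbitRel_apply.1 (Quotient.exact h)
          refine ⟨Pi.single i ((u : ℤ) : ℝ), fun j hj => ?_, fun k => ?_⟩
          · exact Pi.single_eq_of_ne (by rintro rfl; exact hj hi) _
          · rw [Finset.sum_eq_single i (fun j _ hj => by simp [hj]) (by simp), Pi.single_eq_same,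
              ← hu]
            simp [Units.smul_def]
        | zero => exact ⟨0, by simp, by simp⟩
        | add v v' _ _ h h' =>
          obtain ⟨c, hc, hcv⟩ := h
          obtain ⟨c', hc', hcv'⟩ := h'
          exact ⟨c + c', fun i hi => by simp [hc i hi, hc' i hi], fun k => by
            simp [hcv, hcv', add_mul, Finset.sum_add_distrib]⟩
        | smul r v _ h =>
          obtain ⟨c, hc, hcv⟩ := h
          exact ⟨(r : ℝ) • c, fun i hi => by simp [hc i hi], fun k => by
            simp [hcv, Finset.mul_sum, mul_assoc]⟩
      induction hw using Submodule.span_induction with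
      | mem w hw =>
        obtain ⟨v, hv, rfl⟩ := hw
        exact hint v hv
      | zero => exact ⟨0, by simp, by simp⟩
      | add v v' _ _ h h' =>
        obtain ⟨c, hc, hcv⟩ := h
        obtain ⟨c', hc', hcv'⟩ := h'
        exact ⟨c + c', fun i hi => by simp [hc i hi, hc' i hi], fun k => by
          simp [hcv, hcv', add_mul, Finset.sum_add_distrib]⟩
      | smul r v _ h =>
        obtain ⟨c, hc, hcv⟩ := h
        exact ⟨r • c, fun i hi => by simp [hc i hi], fun k => by
          simp [hcv, Finset.mul_sum, mul_assoc]⟩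
    obtain ⟨c, hc, hcw⟩ := hc
    intro i hi
    simp only [hcw, ← hδ, ContinuousMulEquiv.apply_symm_apply, hc i hi]
    simp
  · intro h
    obtain ⟨c, hc, hc0⟩ := exists_torus_exp (δ t)
    refine ⟨fun k => ∑ i, c i * μ i k, ?_, ?_⟩
    · have : (fun k => ∑ i, c i * (μ i k : ℝ)) = ∑ i, c i • fun k => (μ i k : ℝ) := by
        funext k; simp
      rw [this]
      refine Submodule.sum_mem _ fun i _ => ?_
      by_cases hi : i ∈ I
      · exact Submodule.smul_mem _ _
          (Submodule.subset_span ⟨μ i, Submodule.subset_span (hI i hi), rfl⟩)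
      · rw [hc0 i (h i hi), zero_smul]
        exact Submodule.zero_mem _
    · rw [← hδ, ← hc, ContinuousMulEquiv.symm_apply_apply]

variable {P : Set (EuclideanSpace ℝ (Fin (d + 1)))}
  {a : Facet P → EuclideanSpace ℝ (Fin (d + 1)) →L[ℝ] ℝ} {b : Facet P → ℝ}
  {lam : Facet P → SignedVector d}

/-- In suitable coordinates of the torus, the tori of the faces near an edge are coordinate
subtori. -/
theorem EdgeFrame.exists_automorphism {m : EuclideanSpace ℝ (Fin (d + 1)) →L[ℝ] ℝ}
    {G : Fin d → Facet P} (hG : EdgeFrame a lam m G) (h : FacetInequalities a b) :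
    ∃ δ : Torus d ≃ₜ* Torus d, ∀ x ∈ P, ¬ IsVertex P x →
      (∀ F : Facet P, x ∈ (F : Set _) → F ∈ range G) →
      ∀ t, t ∈ faceTorus P lam (activeFace a b x) ↔ ∀ i, x ∉ (G i : Set _) → δ t i = 1 := by
  -- Any choice of signs will do; one `δ` then serves every point whose facets belong to the frame.
  let μ : Fin d → Fin d → ℤ := fun i => (lam (G i)).out
  have hμ : ∀ i, SignedVector.mk (μ i) = lam (G i) := fun i => Quotient.out_eq _
  obtain ⟨δ, hδ⟩ := exists_torus_automorphism (hG.isBasis μ hμ).2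
  refine ⟨δ, fun x hx hxv hxG t => ?_⟩
  have hns : ¬ ∃ v, activeFace a b x = {v} := by
    rintro ⟨v, hv⟩
    have h1 : x ∈ activeFace a b x := self_mem_activeFace (h.eq_polyhedron.le hx)
    rw [hv, mem_singleton_iff] at h1
    refine hxv ?_
    have h2 := h.isFace_activeFace hx
    rwa [hv, ← h1] at h2
  rw [faceTorus, if_neg hns]
  refine mem_subtorus_span_iff hδ (I := {i | x ∈ (G i : Set _)}) ?_ ?_ t
  · rintro ν ⟨F, hF, hν⟩
    have hxF := (h.activeFace_subset_facet_iff hx F).1 hF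
    obtain ⟨i, rfl⟩ := hxG F hxF
    exact ⟨i, hxF, by rw [hν, hμ]⟩
  · intro i hi
    exact ⟨G i, (h.activeFace_subset_facet_iff hx _).2 hi, hμ i⟩

end TorusAutomorphisms

/-! ### Polar coordinates -/

section Polar

variable {d : ℕ}

/-- Multiplication of nonnegative radii by phases. -/
def polarMap (t : Torus d) (s : Fin d → NNReal) : Fin d → ℂ := fun i => (t i : ℂ) * (s i : ℂ)

theorem continuous_polarMap : Continuous fun y : Torus d × (Fin d → NNReal) => polarMap y.1 y.2 := by
  unfold polarMap
  fun_prop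

theorem nnnorm_polarMap (t : Torus d) (s : Fin d → NNReal) (i : Fin d) :
    ‖polarMap t s i‖₊ = s i := by
  ext
  simp [polarMap, Circle.norm_coe]

/-- The phases of the coordinates. -/
noncomputable def phase (z : Fin d → ℂ) : Torus d := fun i => Circle.exp (Complex.arg (z i))

theorem polarMap_phase (z : Fin d → ℂ) : polarMap (phase z) (fun i => ‖z i‖₊) = z := by
  funext i
  simp only [polarMap, phase, Circle.coe_exp, coe_nnnorm]
  rw [mul_comm, Complex.norm_mul_exp_arg_mul_I]

/-- The phase is recovered only at nonzero radius; elsewhere `phase` has an arbitrary value, which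
the quotient forgets. -/
theorem phase_polarMap (t : Torus d) (s : Fin d → NNReal) {i : Fin d} (hi : s i ≠ 0) :
    phase (polarMap t s) i = t i := by
  have h := congrFun (polarMap_phase (polarMap t s)) i
  simp only [nnnorm_polarMap] at h
  have hs : ((s i : NNReal) : ℂ) ≠ 0 := by simpa using hi
  exact Circle.ext (mul_right_cancel₀ hs h)

/-- The map is closed because the torus is compact: the image of a closed set is the projection
along the torus of the closed set `D` of pairs of a point and a compatible phase. -/
theorem isQuotientMap_polarMap (R : Type*) [TopologicalSpace R] :
    IsQuotientMap fun y : Torus d × ((Fin d → NNReal) × R) => (polarMap y.1 y.2.1, y.2.2) := by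
  have hcont : Continuous fun y : Torus d × ((Fin d → NNReal) × R) =>
      (polarMap y.1 y.2.1, y.2.2) :=
    (continuous_polarMap.comp (f := fun y : Torus d × ((Fin d → NNReal) × R) => (y.1, y.2.1))
      (by fun_prop)).prodMk (by fun_prop)
  refine IsClosedMap.isQuotientMap (fun C hC => ?_) hcont fun z =>
    ⟨(phase z.1, (fun i => ‖z.1 i‖₊), z.2), Prod.ext (polarMap_phase z.1) rfl⟩
  let D : Set (Torus d × ((Fin d → ℂ) × R)) :=
    {y | (y.1, ((fun i => ‖y.2.1 i‖₊), y.2.2)) ∈ C ∧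
      polarMap y.1 (fun i => ‖y.2.1 i‖₊) = y.2.1}
  have hD : IsClosed D := by
    refine IsClosed.and (hC.preimage (by fun_prop)) (isClosed_eq ?_ (by fun_prop))
    exact continuous_polarMap.comp
      (f := fun y : Torus d × ((Fin d → ℂ) × R) => (y.1, fun i => ‖y.2.1 i‖₊)) (by fun_prop)
  convert isClosedMap_snd_of_compactSpace D hD using 1
  ext z
  constructor
  · rintro ⟨⟨t, s, r⟩, hy, rfl⟩
    exact ⟨(t, polarMap t s, r), ⟨by simpa only [nnnorm_polarMap] using hy,
      by simp only [nnnorm_polarMap]⟩, rfl⟩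
  · rintro ⟨⟨t, z, r⟩, ⟨hy, hz⟩, rfl⟩
    exact ⟨_, hy, Prod.ext hz rfl⟩

end Polar

/-! ### The quotients of `𝕋ᵈ × S` -/

namespace TorusQuotient

variable {n d : ℕ} {P : Set (EuclideanSpace ℝ (Fin n))} {lam : Facet P → SignedVector d}
  {S S' : Set (EuclideanSpace ℝ (Fin n))}

/-- The class of a pair. -/
def mk (a : Torus d × S) : TorusQuotient P lam S := Quot.mk (torusRel P lam S) a

theorem isQuotientMap_mk : IsQuotientMap (mk : Torus d × S → TorusQuotient P lam S) :=
  isQuotientMap_quot_mk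

theorem continuous_mk : Continuous (mk : Torus d × S → TorusQuotient P lam S) :=
  isQuotientMap_mk.continuous

theorem mk_surjective : Function.Surjective (mk : Torus d × S → TorusQuotient P lam S) :=
  isQuotientMap_mk.surjective

theorem proj_mk (a : Torus d × S) : proj (mk a : TorusQuotient P lam S) = a.2 := rfl

theorem smul_mk (t u : Torus d) (p : S) :
    t • (mk (u, p) : TorusQuotient P lam S) = mk (t * u, p) := rfl

theorem incl_mk (h : S ⊆ S') (t : Torus d) (p : S) :
    incl h (mk (t, p) : TorusQuotient P lam S) = mk (t, Set.inclusion h p) := rfl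

theorem continuous_proj : Continuous (proj : TorusQuotient P lam S → S) :=
  continuous_quot_lift _ continuous_snd

theorem continuous_incl (h : S ⊆ S') :
    Continuous (incl h : TorusQuotient P lam S → TorusQuotient P lam S') := by
  refine isQuotientMap_mk.continuous_iff.2 ?_
  exact continuous_mk.comp
    (continuous_fst.prodMk ((continuous_inclusion h).comp continuous_snd))

theorem proj_smul (t : Torus d) (x : TorusQuotient P lam S) : proj (t • x) = proj x := by
  obtain ⟨⟨u, p⟩, rfl⟩ := mk_surjective x
  rfl

theorem incl_smul (h : S ⊆ S') (t : Torus d) (x : TorusQuotient P lam S) :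
    incl h (t • x) = t • incl h x := by
  obtain ⟨⟨u, p⟩, rfl⟩ := mk_surjective x
  rfl

theorem proj_eq_iff (x y : TorusQuotient P lam S) :
    proj x = proj y ↔ x ∈ MulAction.orbit (Torus d) y := by
  constructor
  · obtain ⟨⟨t, p⟩, rfl⟩ := mk_surjective x
    obtain ⟨⟨u, q⟩, rfl⟩ := mk_surjective y
    intro h
    obtain rfl : p = q := h
    refine ⟨t * u⁻¹, ?_⟩
    simp only [smul_mk, inv_mul_cancel_right]
  · rintro ⟨t, rfl⟩
    exact proj_smul t y

theorem compactSpace (hS : IsCompact S) : CompactSpace (TorusQuotient P lam S) := by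
  have := isCompact_iff_compactSpace.1 hS
  exact inferInstanceAs (CompactSpace (Quot (torusRel P lam S)))

theorem isQuotientMap_proj (hS : IsCompact S) :
    IsQuotientMap (proj : TorusQuotient P lam S → S) := by
  have := compactSpace (P := P) (lam := lam) hS
  exact IsQuotientMap.of_surjective_continuous (fun p => ⟨mk (1, p), rfl⟩) continuous_proj

/-- By compactness and the Hausdorff property, the product of the identity with the quotient map is
again a quotient map, so continuity can be tested on representatives. -/
theorem continuousSMul (hS : IsCompact S) [T2Space (TorusQuotient P lam S)] :
    ContinuousSMul (Torus d) (TorusQuotient P lam S) := by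
  have := isCompact_iff_compactSpace.1 hS
  have hq : IsQuotientMap (Prod.map id mk :
      Torus d × (Torus d × S) → Torus d × TorusQuotient P lam S) :=
    IsQuotientMap.of_surjective_continuous (Function.surjective_id.prodMap mk_surjective)
      (continuous_id.prodMap continuous_mk)
  refine ⟨hq.continuous_iff.2 ?_⟩
  exact continuous_mk.comp (f := fun y : Torus d × (Torus d × S) => (y.1 * y.2.1, y.2.2))
    (by fun_prop)

variable {K : EuclideanSpace ℝ (Fin n) → Subgroup (Torus d)}

/-- Equality of classes, if the relation is given by subgroups. -/
theorem mk_eq_mk_iff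
    (hK : ∀ a b : Torus d × S, torusRel P lam S a b ↔ a.2 = b.2 ∧ a.1 * b.1⁻¹ ∈ K a.2)
    {t u : Torus d} {p q : S} :
    (mk (t, p) : TorusQuotient P lam S) = mk (u, q) ↔ p = q ∧ t * u⁻¹ ∈ K p := by
  have he : Equivalence (torusRel P lam S) := by
    refine ⟨fun a => ?_, fun {a b} hab => ?_, fun {a b c} hab hbc => ?_⟩
    · rw [hK]
      exact ⟨rfl, by rw [mul_inv_cancel]; exact one_mem _⟩
    · rw [hK] at hab ⊢
      refine ⟨hab.1.symm, ?_⟩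
      have := inv_mem hab.2
      rwa [mul_inv_rev, inv_inv, hab.1] at this
    · rw [hK] at hab hbc ⊢
      refine ⟨hab.1.trans hbc.1, ?_⟩
      have := mul_mem hab.2 (hab.1 ▸ hbc.2)
      rwa [mul_assoc, inv_mul_cancel_left] at this
  rw [← hK (t, p) (u, q)]
  constructor
  · intro h
    exact he.eqvGen_iff.1 (Quot.eqvGen_exact h)
  · exact Quot.sound

/-- A chart of `S` with values in a product of half-lines and of `R`, in which the subgroups
`K p` become coordinate subgroups, gives a chart of the quotient. -/
theorem exists_polarChart {R : Type*} [TopologicalSpace R]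
    (hK : ∀ a b : Torus d × S, torusRel P lam S a b ↔ a.2 = b.2 ∧ a.1 * b.1⁻¹ ∈ K a.2)
    (ρ : OpenPartialHomeomorph S ((Fin d → NNReal) × R)) (δ : Torus d ≃ₜ* Torus d)
    (hδ : ∀ p ∈ ρ.source, ∀ t, t ∈ K p ↔ ∀ i, (ρ p).1 i ≠ 0 → δ t i = 1) :
    ∃ e : OpenPartialHomeomorph (TorusQuotient P lam S) ((Fin d → ℂ) × R),
      e.source = proj ⁻¹' ρ.source ∧
      e.target = {z | ((fun i => ‖z.1 i‖₊), z.2) ∈ ρ.target} ∧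
      ∀ t, ∀ p ∈ ρ.source, e (mk (t, p)) = (polarMap (δ t) (ρ p).1, (ρ p).2) := by
  let f : Torus d × S → (Fin d → ℂ) × R := fun y => (polarMap (δ y.1) (ρ y.2).1, (ρ y.2).2)
  -- An arbitrary representative is harmless: two of them differ in phase only at coordinates of
  -- radius zero.
  let F : TorusQuotient P lam S → (Fin d → ℂ) × R := fun x => f (Function.surjInv mk_surjective x)
  have hF : ∀ t, ∀ p ∈ ρ.source, F (mk (t, p)) = f (t, p) := by
    intro t p hp
    obtain ⟨⟨u, q⟩, hy⟩ : ∃ y, Function.surjInv mk_surjective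
      (mk (t, p) : TorusQuotient P lam S) = y := ⟨_, rfl⟩
    have h1 := Function.surjInv_eq mk_surjective (mk (t, p) : TorusQuotient P lam S)
    rw [hy, mk_eq_mk_iff hK] at h1
    obtain ⟨rfl, h1⟩ := h1
    rw [hδ q hp] at h1
    change f (Function.surjInv mk_surjective (mk (t, q) : TorusQuotient P lam S)) = _
    rw [hy]
    refine Prod.ext (funext fun i => ?_) rfl
    by_cases hi : (ρ q).1 i = 0
    · simp [f, polarMap, hi]
    · have h2 := h1 i hi
      rw [map_mul, map_inv, Pi.mul_apply, Pi.inv_apply, mul_inv_eq_one] at h2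
      simp only [f, polarMap, h2]
  let g : (Fin d → ℂ) × R → TorusQuotient P lam S := fun z =>
    mk (δ.symm (phase z.1), ρ.symm ((fun i => ‖z.1 i‖₊), z.2))
  have hg : ∀ t, ∀ y ∈ ρ.target, g (polarMap t y.1, y.2) = mk (δ.symm t, ρ.symm y) := by
    intro t y hy
    simp only [g, nnnorm_polarMap]
    rw [mk_eq_mk_iff hK]
    refine ⟨rfl, (hδ _ (ρ.map_target hy) _).2 fun i hi => ?_⟩
    rw [ρ.right_inv hy] at hi
    rw [map_mul, map_inv, δ.apply_symm_apply, δ.apply_symm_apply, Pi.mul_apply, Pi.inv_apply,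
      phase_polarMap _ _ hi, mul_inv_cancel]
  have hsrc : IsOpen (proj ⁻¹' ρ.source : Set (TorusQuotient P lam S)) :=
    ρ.open_source.preimage continuous_proj
  have htgt : IsOpen {z : (Fin d → ℂ) × R | ((fun i => ‖z.1 i‖₊), z.2) ∈ ρ.target} :=
    ρ.open_target.preimage (by fun_prop)
  refine ⟨{ toFun := F
            invFun := g
            source := proj ⁻¹' ρ.source
            target := {z | ((fun i => ‖z.1 i‖₊), z.2) ∈ ρ.target}
            map_source' := ?_
            map_target' := fun z hz => ρ.map_target hz
            left_inv' := ?_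
            right_inv' := ?_
            open_source := hsrc
            open_target := htgt
            continuousOn_toFun := ?_
            continuousOn_invFun := ?_ }, rfl, rfl, hF⟩
  · intro x hx
    obtain ⟨⟨t, p⟩, rfl⟩ := mk_surjective x
    rw [hF t p hx]
    simp only [mem_ofPred_eq, f, nnnorm_polarMap]
    exact ρ.map_source hx
  · intro x hx
    obtain ⟨⟨t, p⟩, rfl⟩ := mk_surjective x
    rw [hF t p hx]
    have := hg (δ t) (ρ p) (ρ.map_source hx)
    rw [δ.symm_apply_apply, ρ.left_inv (show p ∈ ρ.source from hx)] at this
    exact this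
  · intro z hz
    simp only [g]
    rw [hF _ _ (ρ.map_target hz)]
    simp only [f]
    rw [ρ.right_inv hz, δ.apply_symm_apply]
    exact Prod.ext (polarMap_phase z.1) rfl
  -- Neither the choice of representatives nor the phase is continuous, so continuity in each
  -- direction is tested after composing with the quotient map onto the open domain.
  · rw [isQuotientMap_mk.continuousOn_isOpen_iff hsrc]
    have : ContinuousOn f (mk ⁻¹' (proj ⁻¹' ρ.source : Set (TorusQuotient P lam S))) := by
      have h1 : ContinuousOn (fun y : Torus d × S => ρ y.2)
          (mk ⁻¹' (proj ⁻¹' ρ.source : Set (TorusQuotient P lam S))) :=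
        ρ.continuousOn.comp continuous_snd.continuousOn fun y hy => hy
      refine ContinuousOn.prodMk (continuous_polarMap.comp_continuousOn
        (f := fun y : Torus d × S => (δ y.1, (ρ y.2).1)) ?_) (continuous_snd.comp_continuousOn h1)
      exact (δ.continuous.comp continuous_fst).continuousOn.prodMk
        (continuous_fst.comp_continuousOn h1)
    exact this.congr fun y hy => hF y.1 y.2 hy
  · rw [(isQuotientMap_polarMap R).continuousOn_isOpen_iff htgt]
    have hmem : ∀ y : Torus d × ((Fin d → NNReal) × R), y ∈ (fun y : Torus d ×
        ((Fin d → NNReal) × R) => (polarMap y.1 y.2.1, y.2.2)) ⁻¹'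
          {z : (Fin d → ℂ) × R | ((fun i => ‖z.1 i‖₊), z.2) ∈ ρ.target} → y.2 ∈ ρ.target := by
      intro y hy
      simpa only [mem_preimage, mem_ofPred_eq, nnnorm_polarMap] using hy
    have : ContinuousOn (fun y : Torus d × ((Fin d → NNReal) × R) =>
        (mk (δ.symm y.1, ρ.symm y.2) : TorusQuotient P lam S))
        ((fun y : Torus d × ((Fin d → NNReal) × R) => (polarMap y.1 y.2.1, y.2.2)) ⁻¹'
          {z : (Fin d → ℂ) × R | ((fun i => ‖z.1 i‖₊), z.2) ∈ ρ.target}) := by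
      refine continuous_mk.comp_continuousOn ?_
      exact (δ.symm.continuous.comp continuous_fst).continuousOn.prodMk
        (ρ.continuousOn_symm.comp continuous_snd.continuousOn hmem)
    exact this.congr fun y hy => hg y.1 y.2 (hmem y hy)

end TorusQuotient

/-! ### Local models of the base and of the half-space -/

section BaseCharts

variable {d : ℕ} {E : Type*} [TopologicalSpace E]

/-- A subset of `E` which looks like a product of half-lines and `R` in suitable coordinates. -/
theorem exists_baseChart {R : Type*} [TopologicalSpace R] {S O : Set E} (x₀ : S) (hO : IsOpen O)
    (Λ : E ≃ₜ (Fin d → ℝ) × ℝ) {j : R → ℝ} {k : ℝ → R} (hj : Continuous j) (hk : Continuous k)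
    (hkj : ∀ r, k (j r) = r)
    (hS : ∀ x ∈ O, x ∈ S ↔ (∀ i, 0 ≤ (Λ x).1 i) ∧ (Λ x).2 ∈ range j) :
    ∃ ρ : OpenPartialHomeomorph S ((Fin d → NNReal) × R), ρ.source = Subtype.val ⁻¹' O ∧
      ∀ p : S, ρ p = (fun i => ((Λ p).1 i).toNNReal, k (Λ p).2) := by
  classical
  let f : (Fin d → NNReal) × R → E := fun y => Λ.symm (fun i => (y.1 i : ℝ), j y.2)
  have hf : Continuous f := by fun_prop
  have hfS : ∀ y, f y ∈ O → f y ∈ S := by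
    intro y hy
    rw [hS _ hy]
    simp [f]
  let F : S → (Fin d → NNReal) × R := fun p => (fun i => ((Λ p).1 i).toNNReal, k (Λ p).2)
  have hF : Continuous F := by
    refine Continuous.prodMk (continuous_pi fun i => ?_) (by fun_prop)
    exact continuous_real_toNNReal.comp (by fun_prop)
  have hfF : ∀ p : S, p.1 ∈ O → f (F p) = p := by
    intro p hp
    obtain ⟨h1, r, h2⟩ := (hS _ hp).1 p.2
    simp only [f, F]
    rw [← h2, hkj, h2, Λ.symm_apply_eq]
    exact Prod.ext (funext fun i => Real.coe_toNNReal _ (h1 i)) rfl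
  have hFf : ∀ y (h : f y ∈ S), F ⟨f y, h⟩ = y := by
    intro y h
    simp [F, f, hkj]
  -- The value `x₀` is a default, never taken on the target of the chart.
  let g : (Fin d → NNReal) × R → S := fun y => if h : f y ∈ S then ⟨f y, h⟩ else x₀
  have hg : ∀ y (h : f y ∈ S), g y = ⟨f y, h⟩ := fun y h => dif_pos h
  refine ⟨{ toFun := F
            invFun := g
            source := Subtype.val ⁻¹' O
            target := f ⁻¹' O
            map_source' := fun p hp => by
              rw [mem_preimage, hfF p hp]
              exact hp
            map_target' := fun y hy => by
              rw [hg y (hfS y hy)]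
              exact hy
            left_inv' := fun p hp => by
              rw [hg _ (by rw [hfF p hp]; exact p.2)]
              exact Subtype.ext (hfF p hp)
            right_inv' := fun y hy => by
              rw [hg y (hfS y hy), hFf]
            open_source := hO.preimage continuous_subtype_val
            open_target := hO.preimage hf
            continuousOn_toFun := hF.continuousOn
            continuousOn_invFun := ?_ }, rfl, fun p => rfl⟩
  rw [IsInducing.subtypeVal.continuousOn_iff]
  refine hf.continuousOn.congr fun y hy => ?_
  simp only [Function.comp_apply]
  rw [hg y (hfS y hy)]

/-- The half-space as a product. -/
theorem exists_homeomorph_halfSpace (d : ℕ) :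
    ∃ φ : (Fin d → ℂ) × NNReal ≃ₜ EuclideanHalfSpace (2 * d + 1), ∀ z, (φ z).1 0 = z.2 := by
  let L : (Fin d → ℂ) ≃L[ℝ] (Fin (2 * d) → ℝ) := ContinuousLinearEquiv.ofFinrankEq (by
    rw [Module.finrank_pi_fintype, Module.finrank_pi]
    simp [mul_comm])
  refine ⟨{ toFun := fun z => ⟨WithLp.toLp 2 (Fin.cons (z.2 : ℝ) (L z.1)), z.2.2⟩
            invFun := fun x => (L.symm fun i => x.1 i.succ, ⟨x.1 0, x.2⟩)
            left_inv := fun z => by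
              refine Prod.ext ?_ rfl
              simp
            right_inv := fun x => by
              refine Subtype.ext (WithLp.ofLp_injective 2 (funext fun i => ?_))
              refine Fin.cases ?_ (fun i => ?_) i
              · rfl
              · simp
            continuous_toFun := ?_
            continuous_invFun := ?_ }, fun z => rfl⟩
  · refine Continuous.subtype_mk ((PiLp.continuous_toLp 2 _).comp ?_) _
    refine continuous_pi fun i => ?_
    refine Fin.cases ?_ (fun i => ?_) i
    · simp only [Fin.cons_zero]
      fun_prop
    · simp only [Fin.cons_succ]
      fun_prop
  · have hv : Continuous fun x : EuclideanHalfSpace (2 * d + 1) => x.1 := continuous_subtype_val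
    refine Continuous.prodMk (L.symm.continuous.comp (continuous_pi fun i => ?_))
      (Continuous.subtype_mk ?_ _)
    · exact (EuclideanSpace.proj i.succ).continuous.comp hv
    · exact (EuclideanSpace.proj (0 : Fin (2 * d + 1))).continuous.comp hv

end BaseCharts

/-! ### Charts of the quotient obtained from edge frames -/

section Charts

variable {d : ℕ} {P : Set (EuclideanSpace ℝ (Fin (d + 1)))}
  {a : Facet P → EuclideanSpace ℝ (Fin (d + 1)) →L[ℝ] ℝ} {b : Facet P → ℝ}
  {lam : Facet P → SignedVector d} {S : Set (EuclideanSpace ℝ (Fin (d + 1)))}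

theorem FacetInequalities.torusRel_iff (h : FacetInequalities a b) (hSP : S ⊆ P)
    (y z : Torus d × S) :
    torusRel P lam S y z ↔ y.2 = z.2 ∧ y.1 * z.1⁻¹ ∈ faceTorus P lam (activeFace a b y.2) := by
  have := h.finite
  refine and_congr_right fun _ => ⟨?_, fun hy => ?_⟩
  · rintro ⟨F, hF, hyF, ht⟩
    rwa [h.eq_activeFace hF hyF] at ht
  · exact ⟨_, h.isFace_activeFace (hSP y.2.2),
      mem_intrinsicInterior_activeFace (h.eq_polyhedron.le (hSP y.2.2)), hy⟩

theorem FacetInequalities.mk_eq_mk_iff (h : FacetInequalities a b) (hSP : S ⊆ P)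
    {t u : Torus d} {p q : S} :
    (TorusQuotient.mk (t, p) : TorusQuotient P lam S) = TorusQuotient.mk (u, q) ↔
      p = q ∧ t * u⁻¹ ∈ faceTorus P lam (activeFace a b p) :=
  TorusQuotient.mk_eq_mk_iff (K := fun x => faceTorus P lam (activeFace a b x))
    (h.torusRel_iff hSP)

/-- Charts of the quotient around the points over a point which is not a vertex. -/
theorem EdgeFrame.exists_chart {m : EuclideanSpace ℝ (Fin (d + 1)) →L[ℝ] ℝ}
    {G : Fin d → Facet P} (hG : EdgeFrame a lam m G) (h : FacetInequalities a b)
    (hSP : S ⊆ P) (hSv : ∀ x ∈ S, ¬ IsVertex P x) (x : S)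
    (hxG : ∀ F : Facet P, (x : EuclideanSpace ℝ (Fin (d + 1))) ∈ (F : Set _) → F ∈ range G)
    {R : Type*} [TopologicalSpace R] {j : R → ℝ} {k : ℝ → R} (hj : Continuous j)
    (hk : Continuous k) (hkj : ∀ r, k (j r) = r) (c : ℝ)
    {O : Set (EuclideanSpace ℝ (Fin (d + 1)))} (hO : IsOpen O)
    (hxO : (x : EuclideanSpace ℝ (Fin (d + 1))) ∈ O)
    (hS : ∀ y ∈ O, y ∈ S ↔ y ∈ P ∧ c - m y ∈ range j) :
    ∃ (e : OpenPartialHomeomorph (TorusQuotient P lam S) ((Fin d → ℂ) × R))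
      (δ : Torus d ≃ₜ* Torus d) (U : Set S) (s : S → Fin d → NNReal)
      (T : Set ((Fin d → NNReal) × R)),
      x ∈ U ∧ U ⊆ Subtype.val ⁻¹' O ∧ e.source = TorusQuotient.proj ⁻¹' U ∧
      e.target = {z | ((fun i => ‖z.1 i‖₊), z.2) ∈ T} ∧
      ∀ t, ∀ p ∈ U, e (TorusQuotient.mk (t, p)) = (polarMap (δ t) (s p), k (c - m p)) := by
  have := h.finite
  obtain ⟨Λ, hΛ⟩ := hG.exists_coordinates
  obtain ⟨δ, hδ⟩ := hG.exists_automorphism h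
  -- The coordinates are the slacks of the frame facets together with `c - m`. The parameter space
  -- `R` embeds in the last axis as a half-line or as the point zero in the applications.
  let Λ' := Λ.toHomeomorph.trans (Homeomorph.subLeft ((fun i => b (G i), c) : (Fin d → ℝ) × ℝ))
  have hΛ' : ∀ y, Λ' y = (fun i => b (G i) - a (G i) y, c - m y) := by
    intro y
    change (_ : (Fin d → ℝ) × ℝ) - Λ y = _
    rw [hΛ]
    rfl
  -- Facets outside the frame are kept strictly away, so on `O'` only the frame inequalities define
  -- `P`.
  let O' := O ∩ ⋂ F : {F : Facet P // F ∉ range G}, {y | a F.1 y < b F.1}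
  have hO' : IsOpen O' := hO.inter <| isOpen_iInter_of_finite fun F =>
    isOpen_lt (a F.1).continuous continuous_const
  have hO'lt : ∀ y ∈ O', ∀ F, F ∉ range G → a F y < b F := by
    intro y hy F hF
    exact mem_iInter.1 hy.2 ⟨F, hF⟩
  have hxO' : (x : EuclideanSpace ℝ (Fin (d + 1))) ∈ O' := by
    refine ⟨hxO, mem_iInter.2 fun F => lt_of_le_of_ne (h.eq_polyhedron.le (hSP x.2) F.1) ?_⟩
    exact fun hF => F.2 (hxG F.1 ((h.mem_facet_iff F.1 x (hSP x.2)).2 hF))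
  have hS' : ∀ y ∈ O', y ∈ S ↔ (∀ i, 0 ≤ (Λ' y).1 i) ∧ (Λ' y).2 ∈ range j := by
    intro y hy
    rw [hS y hy.1, hΛ']
    refine and_congr_left fun _ => ?_
    simp only [sub_nonneg]
    rw [show (y ∈ P ↔ _) from iff_of_eq (congrArg (y ∈ ·) h.eq_polyhedron)]
    refine ⟨fun hyP i => hyP (G i), fun hyG F => ?_⟩
    by_cases hF : F ∈ range G
    · obtain ⟨i, rfl⟩ := hF
      exact hyG i
    · exact (hO'lt y hy F hF).le
  obtain ⟨ρ, hρs, hρ⟩ := exists_baseChart x hO' Λ' hj hk hkj hS'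
  obtain ⟨e, hes, het, he⟩ := TorusQuotient.exists_polarChart
    (K := fun x => faceTorus P lam (activeFace a b x)) (h.torusRel_iff hSP) ρ δ (by
      intro p hp t
      rw [hρs] at hp
      have hpO : p.1 ∈ O' := hp
      rw [hδ p (hSP p.2) (hSv p p.2)]
      · refine forall_congr' fun i => imp_congr_left ?_
        rw [hρ, hΛ', h.mem_facet_iff _ _ (hSP p.2)]
        have := h.eq_polyhedron.le (hSP p.2) (G i)
        simp only [ne_eq, Real.toNNReal_eq_zero, sub_nonpos, not_le]
        exact ⟨fun hne => lt_of_le_of_ne this hne, fun hlt => hlt.ne⟩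
      · intro F hF
        by_contra hFG
        exact (hO'lt p hpO F hFG).ne ((h.mem_facet_iff F p (hSP p.2)).1 hF))
  refine ⟨e, δ, Subtype.val ⁻¹' O', fun p => (ρ p).1, ρ.target, hxO', fun y hy => hy.1, ?_, het,
    fun t p hp => ?_⟩
  · rw [hes, hρs]
  · rw [he t p (by rw [hρs]; exact hp)]
    refine Prod.ext rfl ?_
    simp only
    rw [hρ, hΛ']

/-- Every point which is not a vertex has a frame of an edge of its face. -/
theorem FacetInequalities.exists_edgeFrame_of_not_isVertex (h : FacetInequalities a b)
    (hd : 1 ≤ d) (hP : IsEdgeSimplePolytope (d + 1) P) (hlam : IsIsotropyFunction P lam)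
    {x : EuclideanSpace ℝ (Fin (d + 1))} (hx : x ∈ P) (hxv : ¬ IsVertex P x) :
    ∃ (m : EuclideanSpace ℝ (Fin (d + 1)) →L[ℝ] ℝ) (G : Fin d → Facet P), EdgeFrame a lam m G ∧
      ∀ F : Facet P, x ∈ (F : Set _) → F ∈ range G := by
  have := h.finite
  have := hP.isPolytope.finite_vertex
  have hxa := h.eq_polyhedron.le hx
  obtain ⟨u, hu, hu0⟩ : ∃ u, (∀ F, a F x = b F → a F u = 0) ∧ u ≠ 0 := by
    by_contra! hno
    have := h.isFace_activeFace hx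
    rw [activeFace_eq_singleton hxa hno] at this
    exact hxv this
  obtain ⟨m, hm⟩ := SeparatingDual.exists_ne_zero (R := ℝ) hu0
  -- Along `u` the functional `m` is not constant, so each of the finitely many vertices excludes
  -- only one value of `ε`. The small move keeps the sharp inequalities of `x`.
  have hev : ∀ᶠ ε : ℝ in 𝓝[>] 0, ∀ v : Vertex P, m v ≠ m (x + ε • u) := by
    refine Filter.eventually_all.2 fun v => ?_
    have hne : ∀ᶠ ε : ℝ in 𝓝[>] 0, ε ≠ (m v - m x) / m u := by
      by_cases h0 : (0 : ℝ) = (m v - m x) / m u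
      · filter_upwards [self_mem_nhdsWithin] with ε hε
        rw [← h0]
        exact (ne_of_gt hε)
      · exact eventually_ne_nhdsWithin h0
    filter_upwards [hne] with ε hε heq
    refine hε ?_
    rw [heq, map_add, map_smul, smul_eq_mul]
    field_simp
    ring
  obtain ⟨ε, hε, hεv⟩ := ((eventually_active hxa fun F hF => (hu F hF).le).and hev).exists
  have hxP : x + ε • u ∈ P := h.eq_polyhedron.ge fun F => (hε F).1
  obtain ⟨G, hG, hxG⟩ := h.exists_edgeFrame hd hP hlam m hxP fun v hv => hεv ⟨v, hv⟩
  refine ⟨m, G, hG, fun F hF => hxG F ?_⟩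
  rw [h.mem_facet_iff F _ hx] at hF
  rw [h.mem_facet_iff F _ hxP]
  exact (hε F).2.2 ⟨hF, hu F hF⟩

end Charts

/-! ### Separation and orbits in the quotients -/

namespace TorusQuotient

section

variable {n d : ℕ} {P : Set (EuclideanSpace ℝ (Fin n))} {lam : Facet P → SignedVector d}
  {S S' : Set (EuclideanSpace ℝ (Fin n))}

/-- The quotient is Hausdorff if each fibre of the projection is contained in a chart domain. -/
theorem t2Space_of_charts {Y : Type*} [TopologicalSpace Y] [T2Space Y]
    (hY : ∀ p : S, ∃ e : OpenPartialHomeomorph (TorusQuotient P lam S) Y,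
      ∀ x, proj x = p → x ∈ e.source) : T2Space (TorusQuotient P lam S) := by
  refine ⟨fun x y hxy => ?_⟩
  by_cases hp : proj x = proj y
  · obtain ⟨e, he⟩ := hY (proj y)
    have hx := he x hp
    have hy := he y rfl
    obtain ⟨U, V, hU, hV, hxU, hyV, hUV⟩ := t2_separation fun h => hxy (e.injOn hx hy h)
    refine ⟨_, _, e.isOpen_inter_preimage hU, e.isOpen_inter_preimage hV, ⟨hx, hxU⟩, ⟨hy, hyV⟩, ?_⟩
    exact (hUV.preimage e).mono inter_subset_right inter_subset_right
  · exact separated_by_continuous continuous_proj hp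

theorem mem_range_incl_iff (h : S ⊆ S') (x : TorusQuotient P lam S') :
    x ∈ range (incl h : TorusQuotient P lam S → TorusQuotient P lam S') ↔
      (proj x : EuclideanSpace ℝ (Fin n)) ∈ S := by
  obtain ⟨⟨t, p⟩, rfl⟩ := mk_surjective x
  constructor
  · rintro ⟨y, hy⟩
    obtain ⟨⟨u, q⟩, rfl⟩ := mk_surjective y
    rw [← hy]
    exact q.2
  · exact fun hp => ⟨mk (t, ⟨p.1, hp⟩), rfl⟩

variable {K : EuclideanSpace ℝ (Fin n) → Subgroup (Torus d)}

/-- An orbit with stabilizer a coordinate subtorus is a torus. -/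
theorem orbit_homeomorph [T2Space (TorusQuotient P lam S)]
    (hK : ∀ a b : Torus d × S, torusRel P lam S a b ↔ a.2 = b.2 ∧ a.1 * b.1⁻¹ ∈ K a.2)
    (δ : Torus d ≃ₜ* Torus d) (p : S) (I : Set (Fin d))
    (hδ : ∀ t, t ∈ K p ↔ ∀ i, i ∈ I → δ t i = 1) (x : TorusQuotient P lam S)
    (hx : proj x = p) :
    Nonempty (MulAction.orbit (Torus d) x ≃ₜ (I → Circle)) := by
  classical
  obtain ⟨⟨t, q⟩, rfl⟩ := mk_surjective x
  obtain rfl : q = p := hx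
  -- The stabilizer consists of the t with trivial `I`-coordinates after `δ`; filling the other
  -- coordinates with 1 gives a section of the orbit map.
  let E : (I → Circle) → Torus d := fun u i => if h : i ∈ I then u ⟨i, h⟩ else 1
  have hE : Continuous E := by
    refine continuous_pi fun i => ?_
    by_cases h : i ∈ I
    · simp only [E, dif_pos h]; fun_prop
    · simp only [E, dif_neg h]; fun_prop
  let g : (I → Circle) → MulAction.orbit (Torus d) (mk (t, q) : TorusQuotient P lam S) :=
    fun u => ⟨δ.symm (E u) • mk (t, q), _, rfl⟩
  have hg : Continuous g := by
    refine Continuous.subtype_mk ?_ _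
    have : Continuous fun u => (mk (δ.symm (E u) * t, q) : TorusQuotient P lam S) :=
      continuous_mk.comp (((δ.symm.continuous.comp hE).mul continuous_const).prodMk
        continuous_const)
    exact this
  have hmk : ∀ s s' : Torus d, (s • mk (t, q) : TorusQuotient P lam S) = s' • mk (t, q) ↔
      ∀ i, i ∈ I → δ s i = δ s' i := by
    intro s s'
    rw [smul_mk, smul_mk, mk_eq_mk_iff hK, hδ, and_iff_right rfl, mul_inv_rev]
    refine forall₂_congr fun i _ => ?_
    rw [mul_assoc, mul_inv_cancel_left, map_mul, map_inv, Pi.mul_apply, Pi.inv_apply,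
      mul_inv_eq_one]
  have hbij : Function.Bijective g := by
    constructor
    · intro u u' huu'
      have := (hmk _ _).1 (congrArg Subtype.val huu')
      funext i
      have := this i i.2
      rw [δ.apply_symm_apply, δ.apply_symm_apply] at this
      simpa [E] using this
    · rintro ⟨_, s, rfl⟩
      refine ⟨fun i => δ s i, Subtype.ext ((hmk _ _).2 fun i hi => ?_)⟩
      rw [δ.apply_symm_apply]
      simp [E, hi]
  exact ⟨(Continuous.homeoOfEquivCompactToT2 (f := Equiv.ofBijective g hbij) hg).symm⟩

end

end TorusQuotient

/-! ### Manifold structure over the truncation and the cut facets -/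

namespace VertexTruncation

variable {d : ℕ} {P : Set (EuclideanSpace ℝ (Fin (d + 1)))}
  {a : Facet P → EuclideanSpace ℝ (Fin (d + 1)) →L[ℝ] ℝ} {b : Facet P → ℝ}
  {lam : Facet P → SignedVector d}

/-- Charts of the quotient over the truncated polytope. -/
theorem exists_chart_truncation (H : VertexTruncation P) (h : FacetInequalities a b) (hd : 1 ≤ d)
    (hP : IsEdgeSimplePolytope (d + 1) P) (hlam : IsIsotropyFunction P lam) (x : H.truncation) :
    ∃ e : OpenPartialHomeomorph (TorusQuotient P lam H.truncation) ((Fin d → ℂ) × NNReal),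
      (∀ y, TorusQuotient.proj y = x → y ∈ e.source) ∧
      ∀ y ∈ e.source, (∃ v, (TorusQuotient.proj y).1 ∈ H.cutFacet v) ↔ (e y).2 = 0 := by
  have := hP.isPolytope.finite_vertex
  have hSP : H.truncation ⊆ P := fun _ hx => hx.1
  by_cases hxv : ∃ v, x.1 ∈ H.cutFacet v
  · obtain ⟨v, hxv⟩ := hxv
    obtain ⟨G, hG, hxG⟩ := H.exists_edgeFrame_cutFacet h hd hP hlam hxv
    -- Away from the other cuts, the truncation is `P` with the single condition that the last
    -- coordinate, height minus normal, be nonnegative.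
    have hO : IsOpen (⋂ w : {w : Vertex P // w ≠ v}, {y | H.normal w.1 y < H.height w.1}) :=
      isOpen_iInter_of_finite fun w => isOpen_lt (H.normal w.1).continuous continuous_const
    obtain ⟨e, δ, U, s, T, hxU, hUO, hes, -, he⟩ := hG.exists_chart h hSP
      (fun y hy => H.not_isVertex_of_mem hy) x hxG NNReal.continuous_coe continuous_real_toNNReal
      (fun _ => Real.toNNReal_coe) (H.height v) hO
      (mem_iInter.2 fun w => H.normal_lt_of_le h hd hP.isPolytope hP.dim_eq w.2 x.2.1 hxv.1.ge) (by
        intro y hy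
        rw [mem_iInter] at hy
        refine and_congr_right fun _ => ⟨fun hyv => ?_, ?_⟩
        · exact ⟨⟨_, sub_nonneg.2 (hyv v)⟩, rfl⟩
        · rintro ⟨r, hr⟩ w
          by_cases hw : w = v
          · rw [hw, ← sub_nonneg, ← hr]
            exact r.2
          · exact (hy ⟨w, hw⟩).le)
    refine ⟨e, fun y hy => by rw [hes, mem_preimage, hy]; exact hxU, fun y hy => ?_⟩
    rw [hes] at hy
    obtain ⟨⟨t, p⟩, rfl⟩ := TorusQuotient.mk_surjective y
    have hpU : p ∈ U := hy
    rw [he t p hpU, TorusQuotient.proj_mk]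
    simp only [Real.toNNReal_eq_zero, sub_nonpos]
    constructor
    · rintro ⟨w, hw⟩
      by_cases hwv : w = v
      · rw [← hwv]
        exact hw.1.ge
      · exact absurd hw.1 (mem_iInter.1 (hUO hpU) ⟨w, hwv⟩).ne
    · exact fun hp => ⟨v, le_antisymm (p.2.2 v) hp, p.2⟩
  · obtain ⟨m, G, hG, hxG⟩ := h.exists_edgeFrame_of_not_isVertex hd hP hlam x.2.1
      (H.not_isVertex_of_mem x.2)
    -- The last coordinate `c + 1 - m` is at least 1 on `P`, so this chart lands in the half-space
    -- without touching its boundary.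
    obtain ⟨c, hc⟩ := (hP.isPolytope.isCompact.image m.continuous).bddAbove
    have hc : ∀ y ∈ P, m y ≤ c := fun y hy => hc ⟨y, hy, rfl⟩
    have hO : IsOpen (⋂ w : Vertex P, {y | H.normal w y < H.height w}) :=
      isOpen_iInter_of_finite fun w => isOpen_lt (H.normal w).continuous continuous_const
    obtain ⟨e, δ, U, s, T, hxU, hUO, hes, -, he⟩ := hG.exists_chart h hSP
      (fun y hy => H.not_isVertex_of_mem hy) x hxG NNReal.continuous_coe continuous_real_toNNReal
      (fun _ => Real.toNNReal_coe) (c + 1) hO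
      (mem_iInter.2 fun w => lt_of_le_of_ne (x.2.2 w) fun hw => hxv ⟨w, hw, x.2⟩) (by
        intro y hy
        rw [mem_iInter] at hy
        refine and_congr_right fun hyP => ⟨fun _ => ?_, fun _ w => (hy w).le⟩
        exact ⟨⟨c + 1 - m y, by linarith [hc y hyP]⟩, rfl⟩)
    refine ⟨e, fun y hy => by rw [hes, mem_preimage, hy]; exact hxU, fun y hy => ?_⟩
    rw [hes] at hy
    obtain ⟨⟨t, p⟩, rfl⟩ := TorusQuotient.mk_surjective y
    have hpU : p ∈ U := hy
    rw [he t p hpU, TorusQuotient.proj_mk]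
    simp only [Real.toNNReal_eq_zero, sub_nonpos]
    constructor
    · rintro ⟨w, hw⟩
      exact absurd hw.1 (mem_iInter.1 (hUO hpU) w).ne
    · intro hp
      linarith [hc p (hSP p.2)]

theorem t2Space_truncation (H : VertexTruncation P) (h : FacetInequalities a b) (hd : 1 ≤ d)
    (hP : IsEdgeSimplePolytope (d + 1) P) (hlam : IsIsotropyFunction P lam) :
    T2Space (TorusQuotient P lam H.truncation) :=
  TorusQuotient.t2Space_of_charts fun p =>
    (H.exists_chart_truncation h hd hP hlam p).imp fun _ he => he.1

theorem isManifoldWithBoundary (H : VertexTruncation P) (h : FacetInequalities a b) (hd : 1 ≤ d)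
    (hP : IsEdgeSimplePolytope (d + 1) P) (hlam : IsIsotropyFunction P lam) :
    IsManifoldWithBoundary (2 * d + 1) (TorusQuotient P lam H.truncation)
      (⋃ v : Vertex P, Set.range
        (TorusQuotient.incl (P := P) (lam := lam) (H.cutFacet_subset v))) := by
  obtain ⟨φ, hφ⟩ := exists_homeomorph_halfSpace d
  choose e he hb using H.exists_chart_truncation (lam := lam) h hd hP hlam
  let C : ChartedSpace (EuclideanHalfSpace (2 * d + 1)) (TorusQuotient P lam H.truncation) :=
    { atlas := range fun x => (e x).transHomeomorph φ
      chartAt := fun y => (e (TorusQuotient.proj y)).transHomeomorph φ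
      mem_chart_source := fun y => he _ y rfl
      chart_mem_atlas := fun y => ⟨_, rfl⟩ }
  have := TorusQuotient.compactSpace (P := P) (lam := lam) (H.isCompact_truncation hP.isPolytope)
  have : SecondCountableTopology (EuclideanHalfSpace (2 * d + 1)) :=
    φ.symm.isEmbedding.secondCountableTopology
  refine ⟨H.t2Space_truncation h hd hP hlam,
    ChartedSpace.secondCountable_of_sigmaCompact (EuclideanHalfSpace (2 * d + 1)) _, C, ?_⟩
  rintro _ ⟨x, rfl⟩ y hy
  have hy : y ∈ (e x).source := hy
  rw [mem_iUnion]
  simp only [TorusQuotient.mem_range_incl_iff]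
  rw [hb x y hy]
  change _ ↔ (φ (e x y)).1 0 = 0
  rw [hφ]
  simp

/-- A continuous injection from a finite sum of compact spaces to a Hausdorff space. It is injective
because both relations use the faces of `P`, and because distinct cut facets are disjoint. -/
theorem isClosedEmbedding_incl (H : VertexTruncation P) (h : FacetInequalities a b) (hd : 1 ≤ d)
    (hP : IsEdgeSimplePolytope (d + 1) P) (hlam : IsIsotropyFunction P lam) :
    IsClosedEmbedding
      (fun x : Σ v : Vertex P, TorusQuotient P lam (H.cutFacet v) =>
        TorusQuotient.incl (P := P) (lam := lam) (H.cutFacet_subset x.1) x.2) := by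
  have := H.t2Space_truncation (lam := lam) h hd hP hlam
  have := hP.isPolytope.finite_vertex
  have := fun v => TorusQuotient.compactSpace (P := P) (lam := lam)
    (H.isCompact_cutFacet hP.isPolytope v)
  refine Continuous.isClosedEmbedding
    (continuous_sigma fun v => TorusQuotient.continuous_incl (H.cutFacet_subset v)) ?_
  rintro ⟨v, x⟩ ⟨w, y⟩ hxy
  obtain ⟨⟨t, p⟩, rfl⟩ := TorusQuotient.mk_surjective x
  obtain ⟨⟨u, q⟩, rfl⟩ := TorusQuotient.mk_surjective y
  simp only [TorusQuotient.incl_mk] at hxy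
  rw [h.mk_eq_mk_iff fun _ hx => hx.1] at hxy
  obtain ⟨hpq, ht⟩ := hxy
  have hpq : p.1 = q.1 := congrArg Subtype.val hpq
  obtain rfl : v = w := by
    by_contra hvw
    refine Set.eq_empty_iff_forall_notMem.1 (H.disjoint v w hvw) p ⟨⟨p.2.1, ?_⟩, p.2.2.1⟩
    rw [hpq]
    exact q.2.1
  refine congrArg (Sigma.mk v) ?_
  rw [h.mk_eq_mk_iff fun _ hx => hx.2.1]
  exact ⟨Subtype.ext hpq, ht⟩

theorem isEmbedding_incl (H : VertexTruncation P) (h : FacetInequalities a b) (hd : 1 ≤ d)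
    (hP : IsEdgeSimplePolytope (d + 1) P) (hlam : IsIsotropyFunction P lam) (v : Vertex P) :
    IsEmbedding (TorusQuotient.incl (P := P) (lam := lam) (H.cutFacet_subset v)) :=
  (H.isClosedEmbedding_incl (lam := lam) h hd hP hlam).isEmbedding.comp
    (IsEmbedding.sigmaMk (σ := fun v => TorusQuotient P lam (H.cutFacet v)) (i := v))

theorem isLocallyStandard_cutFacet (H : VertexTruncation P) (h : FacetInequalities a b)
    (hd : 1 ≤ d) (hP : IsEdgeSimplePolytope (d + 1) P) (hlam : IsIsotropyFunction P lam)
    (v : Vertex P) : IsLocallyStandard d (TorusQuotient P lam (H.cutFacet v)) := by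
  intro y
  obtain ⟨G, hG, hxG⟩ := H.exists_edgeFrame_cutFacet h hd hP hlam (TorusQuotient.proj y).2
  -- With a one-point parameter space sent to zero, the last coordinate is fixed on the hyperplane
  -- and the chart takes values in ℂᵈ.
  obtain ⟨e, δ, U, s, T, hxU, -, hes, het, he⟩ := hG.exists_chart (R := Unit) (j := fun _ => 0)
    (k := fun _ => Unit.unit) h (fun _ hx => hx.2.1) (fun x hx => H.not_isVertex_of_mem hx.2)
    (TorusQuotient.proj y) hxG continuous_const continuous_const (fun _ => rfl)
    (H.height v) isOpen_univ (mem_univ _) (by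
      intro x _
      rw [H.cutFacet_eq h hd hP.isPolytope hP.dim_eq]
      refine and_congr_right fun _ => ?_
      rw [range_const, mem_singleton_iff, sub_eq_zero, eq_comm])
  let ψ := e.transHomeomorph (Homeomorph.prodPUnit (Fin d → ℂ))
  have hψ : ∀ t, ∀ p ∈ U, ψ (TorusQuotient.mk (t, p)) = polarMap (δ t) (s p) := by
    intro t p hp
    change (e _).1 = _
    rw [he t p hp]
  have hψs : ψ.source = TorusQuotient.proj ⁻¹' U := hes
  refine ⟨ψ, δ, by rw [hψs]; exact hxU, fun t x hx => ?_, fun t z hz => ?_, fun t x hx => ?_⟩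
  · rw [hψs, mem_preimage] at hx ⊢
    rwa [TorusQuotient.proj_smul]
  · have hz : (z, Unit.unit) ∈ e.target := hz
    change ((fun i => (t i : ℂ) * z i), Unit.unit) ∈ e.target
    rw [het] at hz ⊢
    have ht : ∀ i, ‖(t i : ℂ)‖₊ = 1 := fun i => Subtype.ext (Circle.norm_coe (t i))
    simpa [nnnorm_mul, ht] using hz
  · rw [hψs] at hx
    obtain ⟨⟨u, p⟩, rfl⟩ := TorusQuotient.mk_surjective x
    rw [TorusQuotient.smul_mk, hψ _ p hx, hψ _ p hx]
    funext i
    simp [polarMap, mul_assoc]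

theorem isQuasitoricManifold_cutFacet (H : VertexTruncation P) (h : FacetInequalities a b)
    (hd : 1 ≤ d) (hP : IsEdgeSimplePolytope (d + 1) P) (hlam : IsIsotropyFunction P lam)
    (v : Vertex P) :
    IsQuasitoricManifold d (H.cutFacet v) (TorusQuotient P lam (H.cutFacet v))
      TorusQuotient.proj := by
  have hemb := H.isEmbedding_incl h hd hP hlam v
  have hcomp := H.isCompact_cutFacet hP.isPolytope v
  have hQ := H.isManifoldWithBoundary (lam := lam) h hd hP hlam
  have := hQ.t2Space
  have := hQ.secondCountable
  have hT2 : T2Space (TorusQuotient P lam (H.cutFacet v)) := hemb.t2Space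
  refine
    { isSimplePolytope := H.isSimplePolytope_cutFacet h hd hP hlam v
      t2Space := hT2
      secondCountable := hemb.secondCountableTopology
      continuousSMul := TorusQuotient.continuousSMul hcomp
      locallyStandard := H.isLocallyStandard_cutFacet h hd hP hlam v
      isQuotientMap := TorusQuotient.isQuotientMap_proj hcomp
      fiber_eq_orbit := TorusQuotient.proj_eq_iff
      orbit_dim := fun x => ?_ }
  have hp := (TorusQuotient.proj x).2
  obtain ⟨G, hG, hxG⟩ := H.exists_edgeFrame_cutFacet h hd hP hlam hp
  obtain ⟨δ, hδ⟩ := hG.exists_automorphism h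
  refine ⟨_, H.isFace_activeFace_cutFacet h hd hP.isPolytope hP.dim_eq hp,
    H.mem_intrinsicInterior_cutFacet h hd hP.isPolytope hP.dim_eq hp, ?_⟩
  -- The orbit has one circle for each frame facet missing the point, and the dimension of the face
  -- of the cut facet is the same count.
  obtain ⟨f⟩ := TorusQuotient.orbit_homeomorph
    (K := fun x => faceTorus P lam (activeFace a b x)) (h.torusRel_iff fun _ hx => hx.2.1) δ
    (TorusQuotient.proj x) {i | (TorusQuotient.proj x).1 ∉ (G i : Set _)}
    (fun t => by
      rw [hδ _ hp.2.1 (H.not_isVertex_of_mem hp.2) hxG]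
      simp only [mem_ofPred_eq]) x rfl
  rw [H.polyDim_activeFace_cutFacet h hp hG hxG]
  exact ⟨f.trans (Homeomorph.piCongrLeft (Y := fun _ => Circle)
    (Finite.equivFin {i // (TorusQuotient.proj x).1 ∉ (G i : Set _)}))⟩

end VertexTruncation

theorem mainTheorem4 (d : ℕ) (hd : 1 ≤ d) (P : Set (EuclideanSpace ℝ (Fin (d + 1))))
    (hP : IsEdgeSimplePolytope (d + 1) P) (lam : Facet P → SignedVector d)
    (hlam : IsIsotropyFunction P lam) (H : VertexTruncation P) :
    IsManifoldWithBoundary (2 * d + 1) (TorusQuotient P lam H.truncation)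
      (⋃ v : Vertex P, Set.range
        (TorusQuotient.incl (P := P) (lam := lam) (H.cutFacet_subset v))) ∧
    Topology.IsClosedEmbedding
      (fun x : Σ v : Vertex P, TorusQuotient P lam (H.cutFacet v) =>
        TorusQuotient.incl (P := P) (lam := lam) (H.cutFacet_subset x.1) x.2) ∧
    ∀ v : Vertex P,
      (∀ (t : Torus d) (x : TorusQuotient P lam (H.cutFacet v)),
        TorusQuotient.incl (H.cutFacet_subset v) (t • x) =
          t • TorusQuotient.incl (H.cutFacet_subset v) x) ∧
      IsQuasitoricManifold d (H.cutFacet v) (TorusQuotient P lam (H.cutFacet v))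
        TorusQuotient.proj := by
  obtain ⟨hfin, a, b, hPab, hF⟩ := hP.isPolytope.exists_facet_inequalities hP.dim_eq
  have h : FacetInequalities a b := ⟨hfin, hPab, hF⟩
  exact ⟨H.isManifoldWithBoundary h hd hP hlam, H.isClosedEmbedding_incl h hd hP hlam, fun v =>
    ⟨TorusQuotient.incl_smul (H.cutFacet_subset v), H.isQuasitoricManifold_cutFacet h hd hP hlam v⟩⟩
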